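/- Let $L>0$ and $\frac{2\pi^2}{L^2+2\pi^2}<\omega<1$. Let $\phi\in C^2(\mathbb{R})$ be the profile of an even periodic wave with period $L$: a (nonconstant) solution of $$-(1-\phi^2)\phi''+\omega\phi-\phi^3=0$$ with minimal period $L$, with $0<\phi(x)<1$ for all $x$, and even about some point, i.e. $\phi(x_0+x)=\phi(x_0-x)$ for some $x_0\in\mathbb{R}$ and all $x\in\mathbb{R}$. Let $L^2_{\rm per}$ and $H^2_{\rm per}$ be the Lebesgue and Sobolev spaces of complex-valued $L$-periodic functions, and consider on $L^2_{\rm per}$, with domain $H^2_{\rm per}$, the operators $$\mathcal{L}_+=-\partial_x^2+1+(\omega-1)\frac{1+\phi^2}{(1-\phi^2)^2},\qquad \mathcal{L}_-=-\partial_x^2+1+(\omega-1)\frac{1}{1-\phi^2},$$ and on $L^2_{\rm per}\times L^2_{\rm per}$, with domain $H^2_{\rm per}\times H^2_{\rm per}$, the Hessian operator $\mathcal{L}={\rm diag}(\mathcal{L}_+,\mathcal{L}_-)$. For each of these operators let $n(\cdot)$ be the number of negative eigenvalues counted with multiplicity, and $z(\cdot)$ the multiplicity of the eigenvalue $0$.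 Then: 1. $n(\mathcal{L}_+)=z(\mathcal{L}_+)=1$: $\mathcal{L}_+$ has exactly one negative eigenvalue, which is simple, and $\ker\mathcal{L}_+={\rm span}\{\phi'\}$. The rest of the spectrum of $\mathcal{L}_+$ consists of a discrete set of positive eigenvalues of finite multiplicity. 2. $n(\mathcal{L}_-)=0$, $z(\mathcal{L}_-)=1$ and $\ker\mathcal{L}_-={\rm span}\{\phi\}$. The rest of the spectrum of $\mathcal{L}_-$ consists of a discrete set of positive eigenvalues of finite multiplicity. 3. $\mathcal{L}$ has exactly one negative eigenvalue, which is simple; $0$ is a double eigenvalue of $\mathcal{L}$ with $\ker\mathcal{L}={\rm span}\{(\phi',0),(0,\phi)\}$; and the rest of the spectrum of $\mathcal{L}$ consists of a discrete set of positive eigenvalues of finite multiplicity. Here "discrete" means that every bounded set contains only finitely many points of that part of the spectrum. -/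

import Mathlib

open MeasureTheory AddCircle

noncomputable section

namespace PeriodicNLS

/-! ### Spectral notions for unbounded operators -/

section Spectral

variable {X : Type*} [NormedAddCommGroup X] [NormedSpace ℂ X]

/-- `z` belongs to the resolvent set of the unbounded operator `A`: the map
`A - z : dom A → X` has a bounded two-sided inverse `R : X → dom A`. -/
def InResolventSet (A : X →ₗ.[ℂ] X) (z : ℂ) : Prop :=
  ∃ R : X →L[ℂ] X,
    (∀ x : X, ∃ u : A.domain, (u : X) = R x ∧ A u - z • (u : X) = x) ∧
    ∀ u : A.domain, R (A u - z • (u : X)) = u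

/-- The spectrum of an unbounded operator. -/
def spec (A : X →ₗ.[ℂ] X) : Set ℂ := {z | ¬ InResolventSet A z}

/-- The eigenspace `ker (A - z)`, as a subspace of the ambient space. -/
def eigenspace (A : X →ₗ.[ℂ] X) (z : ℂ) : Submodule ℂ X :=
  (LinearMap.ker (A.toFun - z • A.domain.subtype)).map A.domain.subtype

/-- The multiplicity of `z` as an eigenvalue of `A` (zero if `z` is not an eigenvalue). -/
def multiplicity (A : X →ₗ.[ℂ] X) (z : ℂ) : ℕ∞ :=
  Cardinal.toENat (Module.rank ℂ (eigenspace A z))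

/-- The Morse index `n(A)`: the number of negative eigenvalues, counted with multiplicity. -/
def morseIndex (A : X →ₗ.[ℂ] X) : ℕ∞ :=
  ∑' μ : Set.Iio (0 : ℝ), multiplicity A ((μ : ℝ) : ℂ)

/-- The nullity index `z(A)`: the multiplicity of the zero eigenvalue. -/
def nullityIndex (A : X →ₗ.[ℂ] X) : ℕ∞ := multiplicity A 0

/-- Away from the set `S`, the spectrum of `A` consists of positive eigenvalues of finite
multiplicity, and this part of the spectrum is discrete, i.e. it has only finitely many points in
every bounded region. -/
def RestIsDiscretePositive (A : X →ₗ.[ℂ] X) (S : Set ℂ) : Prop :=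
  (∀ z ∈ spec A \ S, (∃ μ : ℝ, 0 < μ ∧ z = (μ : ℂ)) ∧
    multiplicity A z ≠ 0 ∧ multiplicity A z ≠ ⊤) ∧
  ∀ r : ℝ, ((spec A \ S) ∩ Metric.closedBall 0 r).Finite

/-- The block-diagonal operator `diag (A, B)` on the Hilbert sum `X ⊕ X`, with domain
`dom A × dom B`. -/
def blockDiag (A B : X →ₗ.[ℂ] X) : WithLp 2 (X × X) →ₗ.[ℂ] WithLp 2 (X × X) where
  domain :=
    { carrier := {u | u.fst ∈ A.domain ∧ u.snd ∈ B.domain}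
      add_mem' := fun ha hb =>
        ⟨A.domain.add_mem ha.1 hb.1, B.domain.add_mem ha.2 hb.2⟩
      zero_mem' := ⟨A.domain.zero_mem, B.domain.zero_mem⟩
      smul_mem' := fun c _ hu => ⟨A.domain.smul_mem c hu.1, B.domain.smul_mem c hu.2⟩ }
  toFun :=
    { toFun := fun u => WithLp.toLp 2 (A ⟨u.1.fst, u.2.1⟩, B ⟨u.1.snd, u.2.2⟩)
      map_add' := fun u v => by
        have h1 := A.map_add ⟨u.1.fst, u.2.1⟩ ⟨v.1.fst, v.2.1⟩
        have h2 := B.map_add ⟨u.1.snd, u.2.2⟩ ⟨v.1.snd, v.2.2⟩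
        rw [← WithLp.toLp_add, Prod.mk_add_mk, ← h1, ← h2]
        rfl
      map_smul' := fun c u => by
        have h1 := A.map_smul c ⟨u.1.fst, u.2.1⟩
        have h2 := B.map_smul c ⟨u.1.snd, u.2.2⟩
        rw [RingHom.id_apply, ← WithLp.toLp_smul, Prod.smul_mk, ← h1, ← h2]
        rfl }

end Spectral

/-! ### Periodic Sobolev space and Schrödinger operators -/

section Periodic

variable (L : ℝ) [Fact (0 < L)]

/-- The space `L²_per` of complex-valued square-integrable `L`-periodic functions. (The measure is
the Haar measure of the circle of length `L`, normalised to total mass one; this rescales the norm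
by a constant factor only.) -/
abbrev L2per : Type := Lp ℂ 2 (haarAddCircle (T := L))

variable {L}

/-- The class in `L²_per` of a continuous real-valued `L`-periodic function. -/
def toL2per (F : C(AddCircle L, ℝ)) : L2per L :=
  ContinuousMap.toLp (E := ℂ) 2 haarAddCircle ℂ ⟨fun x => (F x : ℂ), by fun_prop⟩

lemma fourierCoeff_add (f g : L2per L) (k : ℤ) :
    fourierCoeff (f + g : L2per L) k = fourierCoeff f k + fourierCoeff g k := by
  rw [← fourierBasis_repr, ← fourierBasis_repr, ← fourierBasis_repr, map_add]
  rfl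

lemma fourierCoeff_smul (c : ℂ) (f : L2per L) (k : ℤ) :
    fourierCoeff (c • f : L2per L) k = c * fourierCoeff f k := by
  rw [← fourierBasis_repr, ← fourierBasis_repr, map_smul]
  rfl

lemma summable_sq_add {w : ℤ → ℝ} (hw : ∀ k, 0 ≤ w k) {a b : ℤ → ℂ}
    (ha : Summable fun k => w k * ‖a k‖ ^ 2) (hb : Summable fun k => w k * ‖b k‖ ^ 2) :
    Summable fun k => w k * ‖a k + b k‖ ^ 2 := by
  refine Summable.of_nonneg_of_le (fun k => mul_nonneg (hw k) (sq_nonneg _)) (fun k => ?_)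
    ((ha.add hb).mul_left 2)
  have h1 : ‖a k + b k‖ ^ 2 ≤ 2 * (‖a k‖ ^ 2 + ‖b k‖ ^ 2) := by
    have := norm_add_le (a k) (b k)
    nlinarith [norm_nonneg (a k + b k), norm_nonneg (a k), norm_nonneg (b k),
      sq_nonneg (‖a k‖ - ‖b k‖)]
  nlinarith [mul_le_mul_of_nonneg_left h1 (hw k)]

variable (L) in
/-- The Sobolev space `H^s_per`, defined by `∑ₖ (1 + |k|²)^s |f̂(k)|² < ∞`. -/
def Hper (s : ℝ) : Submodule ℂ (L2per L) where
  carrier := {f | Summable fun k : ℤ => (1 + (k : ℝ) ^ 2) ^ s * ‖fourierCoeff f k‖ ^ 2}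
  add_mem' {f g} hf hg := by
    simp only [Set.mem_ofPred_eq, fourierCoeff_add] at *
    exact summable_sq_add (fun k => by positivity) hf hg
  zero_mem' := by
    have h : ∀ k, fourierCoeff (0 : L2per L) k = 0 := fun k => by
      rw [← fourierBasis_repr, map_zero]
      rfl
    simp only [Set.mem_ofPred_eq, h]
    simp [summable_zero]
  smul_mem' c f hf := by
    simp only [Set.mem_ofPred_eq, fourierCoeff_smul] at *
    refine (hf.mul_left (‖c‖ ^ 2)).congr fun k => ?_
    rw [norm_mul]; ring

lemma memℓp_secondDeriv (f : Hper L 2) :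
    Memℓp (fun k : ℤ => -((2 * Real.pi * k / L : ℝ) : ℂ) ^ 2 * fourierCoeff f.1 k) 2 := by
  rw [memℓp_gen_iff (by norm_num)]
  have hf : Summable fun k : ℤ => (1 + (k : ℝ) ^ 2) ^ (2 : ℝ) * ‖fourierCoeff f.1 k‖ ^ 2 := f.2
  refine Summable.of_nonneg_of_le (fun k => by positivity) (fun k => ?_)
    (hf.mul_left ((2 * Real.pi / L) ^ 4))
  have h2 : (2 : ENNReal).toReal = (2 : ℕ) := by norm_num
  have h3 : (1 + (k : ℝ) ^ 2) ^ (2 : ℝ) = (1 + (k : ℝ) ^ 2) ^ 2 := by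
    rw [← Real.rpow_natCast]; norm_num
  rw [h2, Real.rpow_natCast, h3, norm_mul, norm_neg, norm_pow, Complex.norm_real,
    Real.norm_eq_abs, sq_abs]
  have h4 : ((2 * Real.pi * k / L) ^ 2 * ‖fourierCoeff f.1 k‖) ^ 2 =
      (2 * Real.pi / L) ^ 4 * (((k : ℝ) ^ 2) ^ 2 * ‖fourierCoeff f.1 k‖ ^ 2) := by ring
  rw [h4]
  gcongr
  linarith

/-- The second derivative `∂ₓ² : H²_per → L²_per`, which multiplies the `k`-th Fourier coefficient
by `(2πik/L)² = -(2πk/L)²`. -/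
def secondDeriv : Hper L 2 →ₗ[ℂ] L2per L where
  toFun f := fourierBasis.repr.symm
    ⟨fun k : ℤ => -((2 * Real.pi * k / L : ℝ) : ℂ) ^ 2 * fourierCoeff f.1 k, memℓp_secondDeriv f⟩
  map_add' f g := by
    rw [← map_add]
    congr 1
    ext k
    simp only [Submodule.coe_add, fourierCoeff_add, lp.coeFn_add, Pi.add_apply]
    ring
  map_smul' c f := by
    rw [RingHom.id_apply, ← map_smul]
    congr 1
    ext k
    simp only [Submodule.coe_smul, fourierCoeff_smul, lp.coeFn_smul, Pi.smul_apply, smul_eq_mul]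
    ring

lemma memLp_mul (V : C(AddCircle L, ℝ)) (f : L2per L) :
    MemLp (fun x => (V x : ℂ) * f x) 2 (haarAddCircle (T := L)) := by
  refine (Lp.memLp f).of_le_mul (c := ‖V‖)
    ((by fun_prop : Continuous fun x => (V x : ℂ)).aestronglyMeasurable.mul
      (Lp.aestronglyMeasurable f)) (Filter.Eventually.of_forall fun x => ?_)
  rw [norm_mul, Complex.norm_real]
  gcongr
  exact V.norm_coe_le_norm x

/-- Multiplication by the continuous periodic potential `V` on `L²_per`. -/
def mulPotential (V : C(AddCircle L, ℝ)) : L2per L →ₗ[ℂ] L2per L where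
  toFun f := (memLp_mul V f).toLp _
  map_add' f g := by
    rw [← MemLp.toLp_add]
    refine MemLp.toLp_congr _ _ ?_
    filter_upwards [Lp.coeFn_add f g] with x hx
    rw [hx, Pi.add_apply, Pi.add_apply, mul_add]
  map_smul' c f := by
    rw [RingHom.id_apply, ← MemLp.toLp_const_smul]
    refine MemLp.toLp_congr _ _ ?_
    filter_upwards [Lp.coeFn_smul c f] with x hx
    rw [hx, Pi.smul_apply, Pi.smul_apply, smul_eq_mul, smul_eq_mul, mul_left_comm]

/-- The Schrödinger operator `-∂ₓ² + V` on `L²_per` with domain `H²_per`. -/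
def schrodinger (V : C(AddCircle L, ℝ)) : L2per L →ₗ.[ℂ] L2per L where
  domain := Hper L 2
  toFun := -secondDeriv + (mulPotential V).comp (Hper L 2).subtype

end Periodic

/-! ### Even periodic waves and their Hessian -/

/-- `φ` is the profile of an even periodic wave with spatial period `L` and frequency `ω`: a
nonconstant solution of `-(1 - φ²) φ'' + ω φ - φ³ = 0` with minimal period `L` and `0 < φ < 1` which
is even about some point `x₀`, where `2π² / (L² + 2π²) < ω < 1`. -/
structure IsEvenWave (L ω : ℝ) (φ : ℝ → ℝ) : Prop where
  omega_gt : 2 * Real.pi ^ 2 / (L ^ 2 + 2 * Real.pi ^ 2) < ω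
  omega_lt : ω < 1
  contDiff : ContDiff ℝ 2 φ
  ode : ∀ x, -(1 - φ x ^ 2) * deriv (deriv φ) x + ω * φ x - φ x ^ 3 = 0
  periodic : Function.Periodic φ L
  minimal : ∀ T : ℝ, 0 < T → T < L → ¬ Function.Periodic φ T
  pos : ∀ x, 0 < φ x
  lt_one : ∀ x, φ x < 1
  even : ∃ x₀, ∀ x, φ (x₀ + x) = φ (x₀ - x)

/-- A continuous `L`-periodic function on the line, as a function on the circle. -/
def onCircle {L : ℝ} (f : ℝ → ℝ) (hf : Continuous f) (hp : Function.Periodic f L) :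
    C(AddCircle L, ℝ) where
  toFun := hp.lift
  continuous_toFun := continuous_quot_lift _ hf

namespace IsEvenWave

variable {L ω : ℝ} {φ : ℝ → ℝ}

lemma periodic_deriv (h : IsEvenWave L ω φ) : Function.Periodic (deriv φ) L := fun x => by
  have h1 : (fun y => φ (y + L)) = φ := funext h.periodic
  rw [← deriv_comp_add_const, h1]

/-- The profile `φ`, as a function on the circle of length `L`. -/
def profile (h : IsEvenWave L ω φ) : C(AddCircle L, ℝ) :=
  onCircle φ h.contDiff.continuous h.periodic

/-- The derivative `φ'` of the profile, as a function on the circle of length `L`. -/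
def profileDeriv (h : IsEvenWave L ω φ) : C(AddCircle L, ℝ) :=
  onCircle (deriv φ) (h.contDiff.continuous_deriv (by norm_num)) h.periodic_deriv

lemma one_sub_sq_ne_zero (h : IsEvenWave L ω φ) (x : AddCircle L) :
    1 - h.profile x ^ 2 ≠ 0 := by
  induction x using QuotientAddGroup.induction_on with
  | H x =>
    have h0 : h.profile (x : AddCircle L) = φ x := h.periodic.lift_coe x
    have h1 := h.pos x
    have h2 := h.lt_one x
    rw [h0]
    nlinarith

/-- The potential `1 + (ω - 1) (1 + φ²) / (1 - φ²)²` of `𝓛₊`. -/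
def potentialPlus (h : IsEvenWave L ω φ) : C(AddCircle L, ℝ) where
  toFun x := 1 + (ω - 1) * ((1 + h.profile x ^ 2) / (1 - h.profile x ^ 2) ^ 2)
  continuous_toFun := by
    have := fun x => pow_ne_zero 2 (h.one_sub_sq_ne_zero x)
    fun_prop (disch := assumption)

/-- The potential `1 + (ω - 1) / (1 - φ²)` of `𝓛₋`. -/
def potentialMinus (h : IsEvenWave L ω φ) : C(AddCircle L, ℝ) where
  toFun x := 1 + (ω - 1) * (1 / (1 - h.profile x ^ 2))
  continuous_toFun := by
    have := h.one_sub_sq_ne_zero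
    fun_prop (disch := assumption)

variable [Fact (0 < L)]

/-- `𝓛₊ = -∂ₓ² + 1 + (ω - 1) (1 + φ²) / (1 - φ²)²` on `L²_per` with domain `H²_per`. -/
def opPlus (h : IsEvenWave L ω φ) : L2per L →ₗ.[ℂ] L2per L := schrodinger h.potentialPlus

/-- `𝓛₋ = -∂ₓ² + 1 + (ω - 1) / (1 - φ²)` on `L²_per` with domain `H²_per`. -/
def opMinus (h : IsEvenWave L ω φ) : L2per L →ₗ.[ℂ] L2per L := schrodinger h.potentialMinus

/-- The Hessian operator `𝓛 = diag (𝓛₊, 𝓛₋)` on `L²_per × L²_per` with domain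
`H²_per × H²_per`. -/
def hessian (h : IsEvenWave L ω φ) :
    WithLp 2 (L2per L × L2per L) →ₗ.[ℂ] WithLp 2 (L2per L × L2per L) :=
  blockDiag h.opPlus h.opMinus

end IsEvenWave

end PeriodicNLS

end

noncomputable section

namespace PeriodicNLS

/-! ### Second-order linear equations on the line -/

/-! The profile equation says 𝓛₋φ = 0, and differentiating it gives 𝓛₊φ' = 0. A Schrödinger operator
on the circle is symmetric with compact resolvent (`hasCompactResolvent_schrodinger`), so its
spectrum consists of real eigenvalues of finite multiplicity, finitely many in each bounded set. Its
eigenfunctions are classical periodic solutions of v'' = (q - μ)v (`exists_of_mem_eigenspace`). It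
remains to count such solutions for μ ≤ 0.

For 𝓛₋ the kernel element φ is positive, hence a ground state: `IsSol.eq_const_mul_of_pos`.

For 𝓛₊ the quadratic form is negative at φ, which yields a negative eigenvalue. Uniqueness is Sturm
theory on the half-period from a maximum a of φ to the minimum b = a + L/2. There -φ' is a positive
Dirichlet solution at energy 0, so there are no Dirichlet solutions below 0. The odd part about a of
a periodic solution is a Dirichlet solution, so below 0 periodic solutions are even and satisfy
Neumann conditions at a and b. Comparison with the even solution u of 𝓛₊u = 0, u(a) > 0, leaves room
for only one negative Neumann eigenvalue, and for nothing but φ' in the kernel, as soon as u'(b) <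
0.

That sign expresses the growth of the period with the amplitude. Put r = (1 - φ²)/(1 - ω) and W = (1
- ω)(r - 1 - log r) as a function of φ. The profile equation is φ'' = -W'(φ)/2, with energy φ'² + W.
Then u = W/W' + sφ' with s' = WW''/W'² - 1/2, s(a) = 0, and u'(b) = s(b)φ''(b) with φ''(b) > 0. An
integration by parts gives s(b) = -∫ φ'² (W/W'²)'' over the half-period, which is negative because
W/W'² is convex in φ (Chicone's criterion). Here W/W'² = (1 - ω)ψ(r)/(4φ²), where ψ = `psi` is
positive, nondecreasing and convex. These facts enter through `shear_neg` and `exists_sturmData`.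

The Hessian is block-diagonal, so its eigenspaces are products and its multiplicities add. -/

/-- `v` is a twice differentiable solution of `v'' = b v` with derivative `v'`. -/
structure IsSol (b v v' : ℝ → ℝ) : Prop where
  deriv₁ : ∀ x, HasDerivAt v (v' x) x
  deriv₂ : ∀ x, HasDerivAt v' (b x * v x) x

namespace IsSol

variable {b q v v' w w' : ℝ → ℝ} {μ ν : ℝ}

lemma continuous (h : IsSol b v v') : Continuous v :=
  continuous_iff_continuousAt.2 fun x => (h.deriv₁ x).continuousAt

lemma continuous' (h : IsSol b v v') : Continuous v' :=
  continuous_iff_continuousAt.2 fun x => (h.deriv₂ x).continuousAt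

lemma add (h : IsSol b v v') (k : IsSol b w w') : IsSol b (v + w) (v' + w') :=
  ⟨fun x => (h.deriv₁ x).add (k.deriv₁ x),
    fun x => ((h.deriv₂ x).add (k.deriv₂ x)).congr_deriv (by simp only [Pi.add_apply]; ring)⟩

lemma smul (h : IsSol b v v') (c : ℝ) : IsSol b (c • v) (c • v') :=
  ⟨fun x => (h.deriv₁ x).const_smul c,
    fun x => ((h.deriv₂ x).const_smul c).congr_deriv
      (by simp only [Pi.smul_apply, smul_eq_mul]; ring)⟩

lemma sub (h : IsSol b v v') (k : IsSol b w w') : IsSol b (v - w) (v' - w') := by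
  have := h.add (k.smul (-1))
  simpa [sub_eq_add_neg] using this

lemma neg (h : IsSol b v v') : IsSol b (-v) (-v') := by
  simpa using h.smul (-1)

/-- Reflection of a solution about a symmetry point of the coefficient. -/
lemma reflect (h : IsSol b v v') {a : ℝ} (hb : ∀ x, b (2 * a - x) = b x) :
    IsSol b (fun x => v (2 * a - x)) (fun x => -v' (2 * a - x)) := by
  have hd : ∀ x : ℝ, HasDerivAt (fun x => 2 * a - x) (-1) x := fun x => by
    simpa using (hasDerivAt_id x).const_sub (2 * a)
  refine ⟨fun x => ?_, fun x => ?_⟩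
  · exact ((h.deriv₁ (2 * a - x)).comp x (hd x)).congr_deriv (by ring)
  · exact (((h.deriv₂ (2 * a - x)).comp x (hd x)).neg).congr_deriv (by rw [hb]; ring)

/-- Uniqueness for the initial value problem. -/
lemma eq_zero (hb : Continuous b) (h : IsSol b v v') {y : ℝ} (h0 : v y = 0) (h1 : v' y = 0)
    (x : ℝ) : v x = 0 ∧ v' x = 0 := by
  -- The unit margin puts both points in the open interval even when x = y; a bound for b there is a
  -- Lipschitz constant of the first-order system.
  obtain ⟨M, hM⟩ := (isCompact_Icc (a := min x y - 1) (b := max x y + 1)).exists_bound_of_continuousOn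
    hb.continuousOn
  have key := ODE_solution_unique_of_mem_Ioo (E := ℝ × ℝ)
    (v := fun t p => (p.2, b t * p.1)) (s := fun _ => Set.univ)
    (K := Real.toNNReal (max 1 M)) (f := fun t => (v t, v' t)) (g := fun _ => (0, 0))
    (a := min x y - 1) (b := max x y + 1) (t₀ := y) ?_ ?_ ?_ ?_ ?_
  · have hx : x ∈ Set.Ioo (min x y - 1) (max x y + 1) :=
      ⟨by linarith [min_le_left x y], by linarith [le_max_left x y]⟩
    have := key hx
    simpa using this
  · intro t ht
    refine LipschitzOnWith.of_dist_le_mul fun p _ p' _ => ?_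
    have hMt : |b t| ≤ M := by simpa using hM t (Set.Ioo_subset_Icc_self ht)
    rw [Real.coe_toNNReal _ (le_trans zero_le_one (le_max_left 1 M)), Prod.dist_eq, Prod.dist_eq]
    refine max_le ?_ ?_
    · calc dist p.2 p'.2 = 1 * dist p.2 p'.2 := (one_mul _).symm
        _ ≤ _ := by gcongr <;> simp
    · rw [Real.dist_eq, ← mul_sub, abs_mul, ← Real.dist_eq]
      gcongr
      · exact hMt.trans (le_max_right _ _)
      · exact le_max_left _ _
  · exact ⟨by linarith [min_le_right x y], by linarith [le_max_right x y]⟩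
  · exact fun t _ => ⟨(h.deriv₁ t).prodMk (h.deriv₂ t), trivial⟩
  · exact fun t _ => ⟨(hasDerivAt_const t ((0 : ℝ), (0 : ℝ))).congr_deriv (by simp; rfl), trivial⟩
  · simp [h0, h1]

lemma ext_of_eq (hb : Continuous b) (h : IsSol b v v') (k : IsSol b w w') {y : ℝ}
    (h0 : v y = w y) (h1 : v' y = w' y) (x : ℝ) : v x = w x ∧ v' x = w' x := by
  have := (h.sub k).eq_zero hb (y := y) (by simp [h0]) (by simp [h1]) x
  exact ⟨sub_eq_zero.1 this.1, sub_eq_zero.1 this.2⟩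

/-- The common coefficient `q` cancels, so where v w has a fixed sign the Wronskian is monotone.
Every comparison below plays this monotonicity against boundary signs. -/
lemma wronskian (h : IsSol (fun x => q x - μ) v v') (k : IsSol (fun x => q x - ν) w w') (x : ℝ) :
    HasDerivAt (fun x => v' x * w x - v x * w' x) ((ν - μ) * (v x * w x)) x :=
  (((h.deriv₂ x).mul (k.deriv₁ x)).sub ((h.deriv₁ x).mul (k.deriv₂ x))).congr_deriv (by ring)

lemma wronskian_strictMonoOn (h : IsSol (fun x => q x - μ) v v')
    (k : IsSol (fun x => q x - ν) w w') {s t : ℝ} (hμ : μ < ν)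
    (hpos : ∀ x ∈ Set.Ioo s t, 0 < v x * w x) :
    StrictMonoOn (fun x => v' x * w x - v x * w' x) (Set.Icc s t) := by
  refine strictMonoOn_of_deriv_pos (convex_Icc s t)
    (fun x _ => (h.wronskian k x).continuousAt.continuousWithinAt) fun x hx => ?_
  rw [interior_Icc] at hx
  rw [(h.wronskian k x).deriv]
  exact mul_pos (by linarith) (hpos x hx)

lemma wronskian_antitoneOn (h : IsSol (fun x => q x - μ) v v')
    (k : IsSol (fun x => q x - ν) w w') {s t : ℝ} (hμ : μ ≤ ν)
    (hneg : ∀ x ∈ Set.Ioo s t, v x * w x ≤ 0) :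
    AntitoneOn (fun x => v' x * w x - v x * w' x) (Set.Icc s t) := by
  refine antitoneOn_of_deriv_nonpos (convex_Icc s t)
    (fun x _ => (h.wronskian k x).continuousAt.continuousWithinAt)
    (fun x _ => (h.wronskian k x).differentiableAt.differentiableWithinAt) fun x hx => ?_
  rw [interior_Icc] at hx
  rw [(h.wronskian k x).deriv]
  exact mul_nonpos_of_nonneg_of_nonpos (by linarith) (hneg x hx)

end IsSol

/-! ### First zeros -/

lemma exists_first_zero {v : ℝ → ℝ} (hv : Continuous v) {a b : ℝ} (hab : a ≤ b) (ha : 0 < v a)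
    (hb : v b ≤ 0) : ∃ z, a < z ∧ z ≤ b ∧ v z = 0 ∧ ∀ x, a ≤ x → x < z → 0 < v x := by
  set S := Set.Icc a b ∩ v ⁻¹' {0} with hS
  have hcomp : IsCompact S := isCompact_Icc.inter_right (isClosed_singleton.preimage hv)
  have hne : S.Nonempty := by
    obtain ⟨x, hx, hx0⟩ := intermediate_value_Icc' hab hv.continuousOn ⟨hb, ha.le⟩
    exact ⟨x, hx, hx0⟩
  obtain ⟨z, hz, hmin⟩ := hcomp.exists_isLeast hne
  have hz0 : v z = 0 := hz.2
  refine ⟨z, lt_of_le_of_ne hz.1.1 ?_, hz.1.2, hz0, fun x hx hxz => ?_⟩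
  · rintro rfl
    exact ha.ne' hz0
  · by_contra hneg
    obtain ⟨y, hy, hy0⟩ := intermediate_value_Icc' hx hv.continuousOn ⟨not_lt.1 hneg, ha.le⟩
    have := hmin ⟨⟨hy.1, hy.2.trans (hxz.le.trans hz.1.2)⟩, hy0⟩
    linarith [hy.2]

lemma eventually_pos_right {v : ℝ → ℝ} {a d : ℝ} (hd : HasDerivAt v d a) (h0 : v a = 0)
    (hpos : 0 < d) {b : ℝ} (hab : a < b) : ∃ c, a < c ∧ c < b ∧ ∀ x, a < x → x ≤ c → 0 < v x := by
  have h1 := (hasDerivAt_iff_tendsto_slope.1 hd).eventually (lt_mem_nhds hpos)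
  have h2 : ∀ᶠ x in nhdsWithin a (Set.Ioi a), 0 < slope v a x :=
    h1.filter_mono (nhdsWithin_mono a fun x hx => ne_of_gt hx)
  obtain ⟨c, hc, hsub⟩ := mem_nhdsGT_iff_exists_Ioo_subset.1 h2
  refine ⟨min ((a + c) / 2) ((a + b) / 2), ?_, ?_, fun x hx hxc => ?_⟩
  · have : a < c := hc
    exact lt_min (by linarith) (by linarith)
  · exact (min_le_right _ _).trans_lt (by linarith)
  · have hxc' : x < c := by
      have : a < c := hc
      linarith [hxc.trans (min_le_left _ _)]
    have hs : 0 < slope v a x := hsub ⟨hx, hxc'⟩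
    rw [slope_def_field, h0, sub_zero] at hs
    exact (div_pos_iff_of_pos_right (by linarith)).1 hs

lemma exists_first_zero_of_deriv_pos {v : ℝ → ℝ} (hv : Continuous v) {a b d : ℝ} (hab : a < b)
    (hd : HasDerivAt v d a) (h0 : v a = 0) (hpos : 0 < d) (hb : v b ≤ 0) :
    ∃ z, a < z ∧ z ≤ b ∧ v z = 0 ∧ ∀ x, a < x → x < z → 0 < v x := by
  obtain ⟨c, hac, hcb, hc⟩ := eventually_pos_right hd h0 hpos hab
  obtain ⟨z, hcz, hzb, hz, hpos⟩ := exists_first_zero hv hcb.le (hc c hac le_rfl) hb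
  refine ⟨z, hac.trans hcz, hzb, hz, fun x hx hxz => ?_⟩
  rcases le_or_gt x c with h | h
  · exact hc x hx h
  · exact hpos x h.le hxz

lemma deriv_nonpos_of_pos_left {v : ℝ → ℝ} {a z d : ℝ} (haz : a < z) (hd : HasDerivAt v d z)
    (hz : v z = 0) (hpos : ∀ x, a < x → x < z → 0 < v x) : d ≤ 0 := by
  have h1 : Filter.Tendsto (slope v z) (nhdsWithin z (Set.Iio z)) (nhds d) :=
    (hasDerivAt_iff_tendsto_slope.1 hd).mono_left (nhdsWithin_mono z fun x hx => ne_of_lt hx)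
  refine le_of_tendsto h1 ?_
  filter_upwards [Ioo_mem_nhdsLT haz] with x hx
  rw [slope_def_field, hz, sub_zero]
  exact (div_neg_of_pos_of_neg (hpos x hx.1 hx.2) (by linarith [hx.2])).le

/-! ### Sturm theory on a half-period -/

/-- The data of Sturm's comparison argument on `[a, b]` for the operator `-∂² + q`: a positive
Dirichlet solution `ρ` and a Neumann solution `u` at `a` whose derivative at `b` is negative. -/
structure SturmData (q ρ ρ' u u' : ℝ → ℝ) (a b : ℝ) : Prop where
  lt : a < b
  cont : Continuous q
  sol_ρ : IsSol q ρ ρ'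
  ρ_left : ρ a = 0
  ρ_right : ρ b = 0
  ρ_pos : ∀ x, a < x → x < b → 0 < ρ x
  sol_u : IsSol q u u'
  u_left : 0 < u a
  u'_left : u' a = 0
  u'_right : u' b < 0

namespace SturmData

variable {q ρ ρ' u u' v v' w w' : ℝ → ℝ} {a b μ ν : ℝ}

lemma cont_sub (h : SturmData q ρ ρ' u u' a b) (μ : ℝ) : Continuous fun x => q x - μ :=
  h.cont.sub continuous_const

lemma sol_ρ_sub (h : SturmData q ρ ρ' u u' a b) : IsSol (fun x => q x - 0) ρ ρ' := by
  simpa using h.sol_ρ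

lemma sol_u_sub (h : SturmData q ρ ρ' u u' a b) : IsSol (fun x => q x - 0) u u' := by
  simpa using h.sol_u

lemma ρ'_left_ne (h : SturmData q ρ ρ' u u' a b) : ρ' a ≠ 0 := fun h0 => by
  have := (h.sol_ρ.eq_zero h.cont h.ρ_left h0 ((a + b) / 2)).1
  have := h.ρ_pos ((a + b) / 2) (by linarith [h.lt]) (by linarith [h.lt])
  linarith

lemma ρ_nonneg (h : SturmData q ρ ρ' u u' a b) {x : ℝ} (hx : a < x) (hxb : x ≤ b) : 0 ≤ ρ x := by
  rcases hxb.lt_or_eq with hlt | rfl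
  · exact (h.ρ_pos x hx hlt).le
  · exact h.ρ_right.ge

/-- If v left a with positive slope, then up to its first zero z ≤ b the Wronskian with ρ would
increase strictly from 0, yet its value v'(z)ρ(z) at z is not positive. Applied to v and -v it kills
the initial slope. -/
lemma dirichlet_aux (h : SturmData q ρ ρ' u u' a b) (hμ : μ < 0)
    (hv : IsSol (fun x => q x - μ) v v') (ha : v a = 0) (hb : v b = 0) : v' a ≤ 0 := by
  by_contra hpos
  obtain ⟨z, haz, hzb, hz, hvpos⟩ :=
    exists_first_zero_of_deriv_pos hv.continuous h.lt (hv.deriv₁ a) ha (not_le.1 hpos) hb.le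
  have hz' := deriv_nonpos_of_pos_left haz (hv.deriv₁ z) hz hvpos
  have hW := hv.wronskian_strictMonoOn h.sol_ρ_sub (s := a) (t := z) hμ
    (fun x hx => mul_pos (hvpos x hx.1 hx.2) (h.ρ_pos x hx.1 (hx.2.trans_le hzb)))
    (Set.left_mem_Icc.2 haz.le) (Set.right_mem_Icc.2 haz.le) haz
  simp only [ha, h.ρ_left, hz] at hW
  nlinarith [h.ρ_nonneg haz hzb]

/-- There are no Dirichlet solutions below zero. -/
lemma dirichlet_eq_zero (h : SturmData q ρ ρ' u u' a b) (hμ : μ < 0)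
    (hv : IsSol (fun x => q x - μ) v v') (ha : v a = 0) (hb : v b = 0) (x : ℝ) : v x = 0 := by
  have h1 := h.dirichlet_aux hμ hv ha hb
  have h2 := h.dirichlet_aux hμ hv.neg (by simp [ha]) (by simp [hb])
  have h3 : v' a = 0 := le_antisymm h1 (by simpa using h2)
  exact (hv.eq_zero (h.cont_sub μ) ha h3 x).1

/-- Below zero a solution has at most one zero: it stays negative after its first zero. -/
lemma neg_of_first_zero (h : SturmData q ρ ρ' u u' a b) (hμ : μ ≤ 0)
    (hv : IsSol (fun x => q x - μ) v v') {z : ℝ} (haz : a < z) (hzb : z < b) (hz : v z = 0)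
    (hz' : v' z < 0) {x : ℝ} (hzx : z < x) (hxb : x ≤ b) : v x < 0 := by
  by_contra hx
  obtain ⟨y, hzy, hyx, hy, hneg⟩ := exists_first_zero_of_deriv_pos hv.neg.continuous hzx
    (hv.neg.deriv₁ z) (by simp [hz]) (by simpa using hz') (by simpa using hx)
  have hy' := deriv_nonpos_of_pos_left hzy (hv.neg.deriv₁ y) hy hneg
  simp only [Pi.neg_apply, neg_eq_zero, Left.neg_nonpos_iff] at hy hy'
  -- A second zero y would make the Wronskian with ρ go from v'(z)ρ(z) < 0 up to v'(y)ρ(y) ≥ 0,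
  -- although vρ ≤ 0 forces it not to increase. Allowing μ = 0 makes the argument available for u
  -- too.
  have hW := hv.wronskian_antitoneOn h.sol_ρ_sub (s := z) (t := y) hμ
    (fun t ht => (mul_neg_of_neg_of_pos (by simpa using hneg t ht.1 ht.2)
      (h.ρ_pos t (haz.trans ht.1) (ht.2.trans_le (hyx.trans hxb)))).le)
    (Set.left_mem_Icc.2 hzy.le) (Set.right_mem_Icc.2 hzy.le) hzy.le
  simp only [hy, hz] at hW
  nlinarith [h.ρ_nonneg (haz.trans hzy) (hyx.trans hxb), h.ρ_pos z haz hzb,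
    mul_neg_of_neg_of_pos hz' (h.ρ_pos z haz hzb)]

lemma deriv_neg_at_first_zero (hb : Continuous q) (hv : IsSol q v v') {z : ℝ} (haz : a < z)
    (ha : 0 < v a) (hz : v z = 0) (hpos : ∀ x, a ≤ x → x < z → 0 < v x) : v' z < 0 := by
  refine lt_of_le_of_ne
    (deriv_nonpos_of_pos_left haz (hv.deriv₁ z) hz fun x hx => hpos x hx.le) fun h0 => ?_
  exact ha.ne' (hv.eq_zero hb hz h0 a).1

/-- A Neumann solution below zero does not vanish. -/
lemma neumann_pos (h : SturmData q ρ ρ' u u' a b) (hμ : μ < 0)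
    (hv : IsSol (fun x => q x - μ) v v') (hva : 0 < v a) (ha : v' a = 0) (hb : v' b = 0) {x : ℝ}
    (hax : a ≤ x) (hxb : x ≤ b) : 0 < v x := by
  by_contra hx
  obtain ⟨z, haz, hzx, hz, hpos⟩ := exists_first_zero hv.continuous hax hva (not_lt.1 hx)
  have hz' := deriv_neg_at_first_zero (h.cont_sub μ) hv haz hva hz hpos
  have hzb : z < b := lt_of_le_of_ne (hzx.trans hxb) (by rintro rfl; exact hz'.ne hb)
  have hneg : ∀ t, z < t → t ≤ b → v t < 0 := fun t =>
    h.neg_of_first_zero hμ.le hv haz hzb hz hz'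
  -- The lower energy oscillates more slowly: if u stayed positive before z, the Wronskian of v and
  -- u would increase strictly from 0 to v'(z)u(z) ≤ 0.
  have huz : ∃ y, a < y ∧ y < z ∧ u y = 0 ∧ ∀ t, a ≤ t → t < y → 0 < u t := by
    by_contra hno
    have hupos : ∀ t, a ≤ t → t < z → 0 < u t := fun t hat htz => by
      by_contra hut
      obtain ⟨y, hay, hyt, hy, hypos⟩ :=
        exists_first_zero h.sol_u.continuous hat h.u_left (not_lt.1 hut)
      exact hno ⟨y, hay, hyt.trans_lt htz, hy, hypos⟩
    have huz : 0 ≤ u z := by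
      refine ge_of_tendsto (h.sol_u.continuous.continuousAt.tendsto.mono_left
        (nhdsWithin_le_nhds (s := Set.Iio z))) ?_
      filter_upwards [Ioo_mem_nhdsLT haz] with t ht using (hupos t ht.1.le ht.2).le
    have hW := hv.wronskian_strictMonoOn h.sol_u_sub (s := a) (t := z) hμ
      (fun t ht => mul_pos (hpos t ht.1.le ht.2) (hupos t ht.1.le ht.2))
      (Set.left_mem_Icc.2 haz.le) (Set.right_mem_Icc.2 haz.le) haz
    simp only [ha, h.u'_left, hz] at hW
    nlinarith
  obtain ⟨y, hay, hyz, hy, hypos⟩ := huz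
  have hy' := deriv_neg_at_first_zero h.cont h.sol_u hay h.u_left hy hypos
  have huneg : ∀ t, y < t → t ≤ b → u t < 0 := fun t =>
    h.neg_of_first_zero le_rfl h.sol_u_sub hay (hyz.trans hzb) hy hy'
  -- On (z, b) both functions are negative, so the Wronskian increases. But it is v'(z)u(z) > 0 at z
  -- and -v(b)u'(b) < 0 at b; this is where u'(b) < 0 is decisive.
  have hW := hv.wronskian_strictMonoOn h.sol_u_sub (s := z) (t := b) hμ
    (fun t ht => mul_pos_of_neg_of_neg (hneg t ht.1 ht.2.le)
      (huneg t (hyz.trans ht.1) ht.2.le))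
    (Set.left_mem_Icc.2 hzb.le) (Set.right_mem_Icc.2 hzb.le) hzb
  simp only [hb, hz] at hW
  nlinarith [mul_pos_of_neg_of_neg hz' (huneg z hyz hzb.le),
    mul_pos_of_neg_of_neg (hneg b hzb le_rfl) h.u'_right]

/-- Both solutions are positive by `neumann_pos`, while the Neumann conditions make their Wronskian
vanish at both ends; strict monotonicity then excludes μ < ν. -/
lemma neumann_unique_aux (h : SturmData q ρ ρ' u u' a b) (hμ : μ < 0) (hν : ν < 0)
    (hv : IsSol (fun x => q x - μ) v v') (hva : 0 < v a) (ha : v' a = 0) (hb : v' b = 0)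
    (hw : IsSol (fun x => q x - ν) w w') (hwa : 0 < w a) (ha' : w' a = 0) (hb' : w' b = 0) :
    ν ≤ μ := by
  by_contra hlt
  have hW := hv.wronskian_strictMonoOn hw (s := a) (t := b) (not_le.1 hlt)
    (fun t ht => mul_pos (h.neumann_pos hμ hv hva ha hb ht.1.le ht.2.le)
      (h.neumann_pos hν hw hwa ha' hb' ht.1.le ht.2.le))
    (Set.left_mem_Icc.2 h.lt.le) (Set.right_mem_Icc.2 h.lt.le) h.lt
  simp [ha, hb, ha', hb'] at hW

/-- There is at most one negative Neumann eigenvalue. -/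
lemma neumann_unique (h : SturmData q ρ ρ' u u' a b) (hμ : μ < 0) (hν : ν < 0)
    (hv : IsSol (fun x => q x - μ) v v') (hva : v a ≠ 0) (ha : v' a = 0) (hb : v' b = 0)
    (hw : IsSol (fun x => q x - ν) w w') (hwa : w a ≠ 0) (ha' : w' a = 0) (hb' : w' b = 0) :
    μ = ν := by
  -- Multiplying by the value at a turns that value into a positive square.
  have hv2 := hv.smul (v a)
  have hw2 := hw.smul (w a)
  have h1 : 0 < (v a • v) a := by simpa using hva
  have h2 : 0 < (w a • w) a := by simpa using hwa
  have h3 : (v a • v') a = 0 := by simp [ha]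
  have h4 : (v a • v') b = 0 := by simp [hb]
  have h5 : (w a • w') a = 0 := by simp [ha']
  have h6 : (w a • w') b = 0 := by simp [hb']
  exact le_antisymm (h.neumann_unique_aux hν hμ hw2 h2 h5 h6 hv2 h1 h3 h4)
    (h.neumann_unique_aux hμ hν hv2 h1 h3 h4 hw2 h2 h5 h6)

end SturmData

/-! ### Periodic solutions -/

lemma IsSol.periodic_deriv {b v v' : ℝ → ℝ} {L : ℝ} (h : IsSol b v v')
    (hp : Function.Periodic v L) : Function.Periodic v' L := fun x => by
  have h1 := (h.deriv₁ (x + L)).comp_add_const x L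
  rw [show (fun y => v (y + L)) = v from funext hp] at h1
  exact h1.unique (h.deriv₁ x)

namespace SturmData

variable {q ρ ρ' u u' v v' w w' : ℝ → ℝ} {a b μ ν L : ℝ}

/-- Below zero, periodic solutions are even. -/
lemma periodic_even (h : SturmData q ρ ρ' u u' a b) (hb : b = a + L / 2)
    (hq : ∀ x, q (2 * a - x) = q x) (hμ : μ < 0) (hv : IsSol (fun x => q x - μ) v v')
    (hp : Function.Periodic v L) (x : ℝ) : v (2 * a - x) = v x := by
  have h1 := hv.reflect (a := a) (fun x => by rw [hq])
  -- The difference between the reflection and v vanishes at a trivially, and at b because 2a - b =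
  -- b - L.
  have h2 := h.dirichlet_eq_zero hμ (h1.sub hv) (by simp [two_mul]) (by
    have := hp (2 * a - b)
    rw [show 2 * a - b + L = b by rw [hb]; ring] at this
    simp [this]) x
  exact sub_eq_zero.1 h2

/-- Below zero, periodic solutions satisfy Neumann conditions on the half-period. -/
lemma periodic_neumann (h : SturmData q ρ ρ' u u' a b) (hb : b = a + L / 2)
    (hq : ∀ x, q (2 * a - x) = q x) (hμ : μ < 0) (hv : IsSol (fun x => q x - μ) v v')
    (hp : Function.Periodic v L) : v' a = 0 ∧ v' b = 0 := by
  have heven := h.periodic_even hb hq hμ hv hp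
  have h1 := hv.reflect (a := a) (fun x => by rw [hq])
  have h2 : ∀ x, -v' (2 * a - x) = v' x := fun x => by
    have h3 := h1.deriv₁ x
    simp only [heven] at h3
    exact h3.unique (hv.deriv₁ x)
  have h4 := h2 a
  have h5 := h2 b
  have h6 := hv.periodic_deriv hp (2 * a - b)
  rw [show 2 * a - b + L = b by rw [hb]; ring] at h6
  rw [show 2 * a - a = a by ring] at h4
  exact ⟨by linarith, by linarith⟩

lemma periodic_eq_zero (h : SturmData q ρ ρ' u u' a b) (hb : b = a + L / 2)
    (hq : ∀ x, q (2 * a - x) = q x) (hμ : μ < 0) (hv : IsSol (fun x => q x - μ) v v')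
    (hp : Function.Periodic v L) (hva : v a = 0) (x : ℝ) : v x = 0 :=
  (hv.eq_zero (h.cont_sub μ) hva (h.periodic_neumann hb hq hμ hv hp).1 x).1

/-- There is at most one negative periodic eigenvalue. -/
lemma periodic_unique (h : SturmData q ρ ρ' u u' a b) (hb : b = a + L / 2)
    (hq : ∀ x, q (2 * a - x) = q x) (hμ : μ < 0) (hν : ν < 0)
    (hv : IsSol (fun x => q x - μ) v v') (hp : Function.Periodic v L) (hv0 : ∃ x, v x ≠ 0)
    (hw : IsSol (fun x => q x - ν) w w') (hp' : Function.Periodic w L) (hw0 : ∃ x, w x ≠ 0) :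
    μ = ν := by
  obtain ⟨x, hx⟩ := hv0
  obtain ⟨y, hy⟩ := hw0
  have h1 := h.periodic_neumann hb hq hμ hv hp
  have h2 := h.periodic_neumann hb hq hν hw hp'
  exact h.neumann_unique hμ hν hv (fun h0 => hx (h.periodic_eq_zero hb hq hμ hv hp h0 x)) h1.1 h1.2
    hw (fun h0 => hy (h.periodic_eq_zero hb hq hν hw hp' h0 y)) h2.1 h2.2

/-- The periodic solutions at energy zero are the multiples of `ρ`. -/
lemma periodic_kernel (h : SturmData q ρ ρ' u u' a b) (hb : b = a + L / 2)
    (hq : ∀ x, q (2 * a - x) = q x) (hv : IsSol q v v') (hp : Function.Periodic v L) :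
    ∃ c, ∀ x, v x = c * ρ x := by
  have h1 := hv.reflect (a := a) hq
  have h6 := hv.periodic_deriv hp (2 * a - b)
  rw [show 2 * a - b + L = b by rw [hb]; ring] at h6
  have haa : 2 * a - a = a := by ring
  -- The symmetrised solution has zero slope at a, so it is a multiple of u. By periodicity its
  -- slope at b is zero as well, while u'(b) ≠ 0: the multiple is zero, hence v(a) = 0.
  have h2 := IsSol.ext_of_eq h.cont (hv.add h1) (h.sol_u.smul (2 * v a / u a)) (y := a)
    (by simp only [Pi.add_apply, Pi.smul_apply, smul_eq_mul, haa]
        field_simp [h.u_left.ne']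
        ring)
    (by simp [haa, h.u'_left])
  have h3 : v a = 0 := by
    have h4 := (h2 b).2
    simp only [Pi.add_apply, Pi.smul_apply, smul_eq_mul, h6, add_neg_cancel] at h4
    rcases mul_eq_zero.1 h4.symm with h5 | h5
    · rcases div_eq_zero_iff.1 h5 with h7 | h7
      · linarith
      · exact absurd h7 h.u_left.ne'
    · exact absurd h5 h.u'_right.ne
  refine ⟨v' a / ρ' a, fun x => ?_⟩
  have h4 := (IsSol.ext_of_eq h.cont hv (h.sol_ρ.smul (v' a / ρ' a)) (y := a)
    (by simp [h3, h.ρ_left]) (by simp [div_mul_cancel₀ _ h.ρ'_left_ne]) x).1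
  simpa using h4

end SturmData

/-- A positive periodic solution at energy zero forbids lower periodic eigenvalues, and spans the
periodic solutions at energy zero. -/
lemma IsSol.eq_const_mul_of_pos {q v v' w w' : ℝ → ℝ} {L μ : ℝ}
    (hw : IsSol q w w') (hpw : Function.Periodic w L) (hpos : ∀ x, 0 < w x) (hL : 0 < L)
    (hμ : μ ≤ 0) (hv : IsSol (fun x => q x - μ) v v') (hp : Function.Periodic v L) :
    (∃ c, ∀ x, v x = c * w x) ∧ (μ < 0 → ∀ x, v x = 0) := by
  have hw' : IsSol (fun x => q x - 0) w w' := by simpa using hw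
  have hk : ∀ x, HasDerivAt (fun x => v x / w x) ((v' x * w x - v x * w' x) / w x ^ 2) x :=
    fun x => (hv.deriv₁ x).div (hw.deriv₁ x) (hpos x).ne'
  -- With k = v/w and Wronskian ω₀ = v'w - vw', the product kω₀ has derivative (ω₀/w)² - μv² ≥ 0. A
  -- monotone periodic function is constant, so both terms vanish: k is constant, and v = 0 if μ <
  -- 0.
  have hM : ∀ x, HasDerivAt (fun x => v x / w x * (v' x * w x - v x * w' x))
      (((v' x * w x - v x * w' x) / w x) ^ 2 - μ * v x ^ 2) x := fun x =>
    ((hk x).mul (hv.wronskian hw' x)).congr_deriv (by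
      have := (hpos x).ne'
      field_simp
      ring)
  have hmono : Monotone fun x => v x / w x * (v' x * w x - v x * w' x) :=
    monotone_of_deriv_nonneg (fun x => (hM x).differentiableAt) fun x => by
      rw [(hM x).deriv]
      nlinarith [sq_nonneg ((v' x * w x - v x * w' x) / w x), sq_nonneg (v x)]
  have hper : Function.Periodic (fun x => v x / w x * (v' x * w x - v x * w' x)) L := fun x => by
    simp only [hp x, hpw x, hv.periodic_deriv hp x, hw.periodic_deriv hpw x]
  have hconst : ∀ x y, v x / w x * (v' x * w x - v x * w' x) ≤
      v y / w y * (v' y * w y - v y * w' y) := fun x y => by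
    obtain ⟨n, hn⟩ := exists_nat_gt ((x - y) / L)
    have h1 := hper.nat_mul n y
    rw [← h1]
    refine hmono ?_
    rw [div_lt_iff₀ hL] at hn
    linarith
  have hzero : ∀ x, ((v' x * w x - v x * w' x) / w x) ^ 2 - μ * v x ^ 2 = 0 := fun x => by
    have h1 : (fun x => v x / w x * (v' x * w x - v x * w' x)) =
        fun _ => v 0 / w 0 * (v' 0 * w 0 - v 0 * w' 0) :=
      funext fun y => le_antisymm (hconst y 0) (hconst 0 y)
    have h2 := hM x
    rw [h1] at h2
    exact h2.unique (hasDerivAt_const x _)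
  have hW : ∀ x, v' x * w x - v x * w' x = 0 := fun x => by
    have h1 : ((v' x * w x - v x * w' x) / w x) ^ 2 = 0 := by
      nlinarith [hzero x, sq_nonneg ((v' x * w x - v x * w' x) / w x), sq_nonneg (v x)]
    rcases div_eq_zero_iff.1 (pow_eq_zero_iff (by norm_num) |>.1 h1) with h2 | h2
    · exact h2
    · exact absurd h2 (hpos x).ne'
  refine ⟨⟨v 0 / w 0, fun x => ?_⟩, fun hμ' x => ?_⟩
  · have h1 := is_const_of_deriv_eq_zero (fun x => (hk x).differentiableAt)
      (fun x => by rw [(hk x).deriv, hW x, zero_div]) x 0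
    rw [← h1, div_mul_cancel₀ _ (hpos x).ne']
  · have h1 := hzero x
    rw [hW x, zero_div] at h1
    have h2 : v x ^ 2 = 0 := by nlinarith [sq_nonneg (v x)]
    exact pow_eq_zero_iff (by norm_num) |>.1 h2

/-! ### The function `(r - 1 - log r) / (r - 1)²` -/

/-- `r - 1 - log r`. -/
def logRem (r : ℝ) : ℝ := r - 1 - Real.log r

/-- The analytic extension of `(r - 1 - log r) / (r - 1)²` across `r = 1`. -/
def logQuot : ℝ → ℝ := dslope (dslope logRem 1) 1

lemma hasDerivAt_logRem {r : ℝ} (hr : 0 < r) : HasDerivAt logRem (1 - r⁻¹) r := by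
  have := ((hasDerivAt_id r).sub_const 1).sub (Real.hasDerivAt_log hr.ne')
  exact this

lemma analyticAt_logRem {r : ℝ} (hr : 0 < r) : AnalyticAt ℝ logRem r :=
  (analyticAt_id.sub analyticAt_const).sub (analyticAt_log hr)

lemma logRem_one : logRem 1 = 0 := by simp [logRem]

lemma sq_mul_logQuot (r : ℝ) : (r - 1) ^ 2 * logQuot r = logRem r := by
  have h1 : (r - 1) • dslope (dslope logRem 1) 1 r = dslope logRem 1 r - dslope logRem 1 1 :=
    sub_smul_dslope _ _ _
  have h2 : (r - 1) • dslope logRem 1 r = logRem r - logRem 1 := sub_smul_dslope _ _ _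
  rw [dslope_same logRem, (hasDerivAt_logRem one_pos).deriv] at h1
  simp only [smul_eq_mul, inv_one, sub_self, sub_zero, logRem_one] at h1 h2
  rw [logQuot, sq, mul_assoc, h1, h2]

lemma logQuot_of_ne {r : ℝ} (hr : r ≠ 1) : logQuot r = logRem r / (r - 1) ^ 2 := by
  rw [← sq_mul_logQuot, mul_div_cancel_left₀]
  exact pow_ne_zero 2 (sub_ne_zero.2 hr)

lemma analyticAt_logQuot {r : ℝ} (hr : 0 < r) : AnalyticAt ℝ logQuot r := by
  rcases eq_or_ne r 1 with rfl | h1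
  · obtain ⟨p, hp⟩ := analyticAt_logRem one_pos
    exact hp.has_fpower_series_dslope_fslope.has_fpower_series_dslope_fslope.analyticAt
  · have h2 : AnalyticAt ℝ (fun r => logRem r / (r - 1) ^ 2) r :=
      (analyticAt_logRem hr).div ((analyticAt_id.sub analyticAt_const).pow 2)
        (pow_ne_zero 2 (sub_ne_zero.2 h1))
    refine h2.congr ?_
    filter_upwards [isOpen_ne.mem_nhds h1] with s hs using (logQuot_of_ne hs).symm

lemma hasDerivAt_logQuot {r : ℝ} (hr : 0 < r) : HasDerivAt logQuot (deriv logQuot r) r :=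
  (analyticAt_logQuot hr).differentiableAt.hasDerivAt

/-- A continuous function which is nonnegative off a point is nonnegative at the point. -/
lemma nonneg_of_punctured {g : ℝ → ℝ} {c : ℝ} (hg : ContinuousAt g c)
    (h : ∀ᶠ x in nhdsWithin c {c}ᶜ, 0 ≤ g x) : 0 ≤ g c :=
  ge_of_tendsto (hg.tendsto.mono_left nhdsWithin_le_nhds) h

lemma eventually_punctured_pos {c : ℝ} (hc : 0 < c) :
    ∀ᶠ x in nhdsWithin c {c}ᶜ, 0 < x ∧ x ≠ c := by
  filter_upwards [nhdsWithin_le_nhds (lt_mem_nhds hc), self_mem_nhdsWithin] with x hx hxc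
  exact ⟨hx, hxc⟩

/-- The differential equation of `logQuot`. -/
lemma logQuot_ode {r : ℝ} (hr : 0 < r) :
    r * (2 * logQuot r + (r - 1) * deriv logQuot r) = 1 := by
  -- Differentiate (r - 1)² `logQuot` r = r - 1 - log r and cancel one factor r - 1; the value at r
  -- = 1 follows by continuity.
  have off : ∀ s, 0 < s → s ≠ 1 → s * (2 * logQuot s + (s - 1) * deriv logQuot s) = 1 := by
    intro s hs h1
    have h2 : HasDerivAt (fun r => (r - 1) ^ 2 * logQuot r)
        (2 * (s - 1) * logQuot s + (s - 1) ^ 2 * deriv logQuot s) s := by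
      refine ((((hasDerivAt_id s).sub_const 1).pow 2).mul (hasDerivAt_logQuot hs)).congr_deriv ?_
      simp
    rw [show (fun r => (r - 1) ^ 2 * logQuot r) = logRem from funext sq_mul_logQuot] at h2
    have h3 := h2.unique (hasDerivAt_logRem hs)
    have h4 : s - 1 ≠ 0 := sub_ne_zero.2 h1
    refine mul_left_cancel₀ h4 ?_
    have h5 : s * s⁻¹ = 1 := mul_inv_cancel₀ hs.ne'
    linear_combination s * h3 - h5
  rcases eq_or_ne r 1 with rfl | h1
  · have hc : ContinuousAt (fun s => s * (2 * logQuot s + (s - 1) * deriv logQuot s)) 1 := by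
      have h2 := (analyticAt_logQuot one_pos).continuousAt
      have h3 := (analyticAt_logQuot one_pos).deriv.continuousAt
      fun_prop
    refine tendsto_nhds_unique (hc.tendsto.mono_left
      (nhdsWithin_le_nhds (s := {(1 : ℝ)}ᶜ))) ?_
    refine tendsto_const_nhds.congr' ?_
    filter_upwards [eventually_punctured_pos one_pos] with s hs using (off s hs.1 hs.2).symm
  · exact off r hr h1

lemma logQuot_pos {r : ℝ} (hr : 0 < r) : 0 < logQuot r := by
  rcases eq_or_ne r 1 with rfl | h1
  · have := logQuot_ode one_pos
    linarith
  · rw [logQuot_of_ne h1]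
    have h2 := Real.log_lt_sub_one_of_pos hr h1
    have h3 : r - 1 ≠ 0 := sub_ne_zero.2 h1
    exact div_pos (by rw [logRem]; linarith) (by positivity)

/-- The difference with the rational approximation has derivative (s - 1)³/(s(1 + 2s)²), so its
minimum is the value 0 at s = 1. The inequality is the nonnegativity of the numerator of ψ''. -/
lemma pade_le_logRem {r : ℝ} (hr : 0 < r) : 3 * (r - 1) ^ 2 ≤ 2 * (1 + 2 * r) * logRem r := by
  set g : ℝ → ℝ := fun s => logRem s - 3 * (s - 1) ^ 2 / (2 * (1 + 2 * s)) with hg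
  have hd : ∀ s, 0 < s → HasDerivAt g ((s - 1) ^ 3 / (s * (1 + 2 * s) ^ 2)) s := fun s hs => by
    have h1 : HasDerivAt (fun s : ℝ => 3 * (s - 1) ^ 2) (3 * (2 * (s - 1))) s := by
      simpa using (((hasDerivAt_id s).sub_const 1).pow 2).const_mul 3
    have h2 : HasDerivAt (fun s : ℝ => 2 * (1 + 2 * s)) (2 * 2) s := by
      simpa using (((hasDerivAt_id s).const_mul 2).const_add 1).const_mul 2
    refine ((hasDerivAt_logRem hs).sub (h1.div h2 (by positivity))).congr_deriv ?_
    field_simp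
    ring
  have hg1 : g 1 = 0 := by simp [hg, logRem_one]
  have hgr : 0 ≤ g r := by
    rcases le_total r 1 with h | h
    · have hanti : AntitoneOn g (Set.Icc r 1) := by
        refine antitoneOn_of_deriv_nonpos (convex_Icc _ _)
          (fun s hs => (hd s (hr.trans_le hs.1)).continuousAt.continuousWithinAt)
          (fun s hs => ?_) (fun s hs => ?_) <;> rw [interior_Icc] at hs
        · exact (hd s (hr.trans hs.1)).differentiableAt.differentiableWithinAt
        · have := hr.trans hs.1
          rw [(hd s this).deriv]
          exact div_nonpos_of_nonpos_of_nonneg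
            ((show Odd 3 by decide).pow_nonpos (by linarith [hs.2])) (by positivity)
      rw [← hg1]
      exact hanti (Set.left_mem_Icc.2 h) (Set.right_mem_Icc.2 h) h
    · have hmono : MonotoneOn g (Set.Icc 1 r) := by
        refine monotoneOn_of_deriv_nonneg (convex_Icc _ _)
          (fun s hs => (hd s (one_pos.trans_le hs.1)).continuousAt.continuousWithinAt)
          (fun s hs => ?_) (fun s hs => ?_) <;> rw [interior_Icc] at hs
        · exact (hd s (one_pos.trans hs.1)).differentiableAt.differentiableWithinAt
        · have := one_pos.trans hs.1
          rw [(hd s this).deriv]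
          exact div_nonneg (pow_nonneg (by linarith [hs.1]) 3) (by positivity)
      rw [← hg1]
      exact hmono (Set.left_mem_Icc.2 h) (Set.right_mem_Icc.2 h) h
  have h3 : 3 * (r - 1) ^ 2 / (2 * (1 + 2 * r)) ≤ logRem r := sub_nonneg.1 hgr
  rw [div_le_iff₀ (by positivity)] at h3
  linarith

/-- The second factor has derivative 2(s - 1)²/s ≥ 0 and vanishes at 1, so it has the sign of r - 1.
This product is the numerator of ψ' up to the factor r. -/
lemma logRem_cubic_nonneg {r : ℝ} (hr : 0 < r) :
    0 ≤ (r - 1) * ((r - 1) ^ 2 - 2 * logRem r) := by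
  set g : ℝ → ℝ := fun s => (s - 1) ^ 2 - 2 * logRem s with hg
  have hd : ∀ s, 0 < s → HasDerivAt g (2 * (s - 1) ^ 2 / s) s := fun s hs => by
    refine ((((hasDerivAt_id s).sub_const 1).pow 2).sub
      ((hasDerivAt_logRem hs).const_mul 2)).congr_deriv ?_
    simp only [id]
    field_simp
    push_cast
    ring
  have hg1 : g 1 = 0 := by simp [hg, logRem_one]
  have hmono : MonotoneOn g (Set.Ioi 0) := by
    refine monotoneOn_of_deriv_nonneg (convex_Ioi _)
      (fun s hs => (hd s hs).continuousAt.continuousWithinAt)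
      (fun s hs => ?_) (fun s hs => ?_) <;> rw [interior_Ioi] at hs
    · exact (hd s hs).differentiableAt.differentiableWithinAt
    · have : 0 < s := hs
      rw [(hd s hs).deriv]
      positivity
  change 0 ≤ (r - 1) * g r
  rcases le_total r 1 with h | h
  · have := hmono hr (Set.mem_Ioi.2 one_pos) h
    exact mul_nonneg_of_nonpos_of_nonpos (by linarith) (by linarith)
  · have := hmono (Set.mem_Ioi.2 one_pos) hr h
    exact mul_nonneg (by linarith) (by linarith)

/-- `r² (r - 1 - log r) / (r - 1)²`. -/
def psi (r : ℝ) : ℝ := r ^ 2 * logQuot r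

lemma analyticAt_psi {r : ℝ} (hr : 0 < r) : AnalyticAt ℝ psi r :=
  (analyticAt_id.pow 2).mul (analyticAt_logQuot hr)

lemma psi_pos {r : ℝ} (hr : 0 < r) : 0 < psi r := mul_pos (by positivity) (logQuot_pos hr)

lemma hasDerivAt_psi {r : ℝ} (hr : 0 < r) : HasDerivAt psi (deriv psi r) r :=
  (analyticAt_psi hr).differentiableAt.hasDerivAt

lemma hasDerivAt_deriv_psi {r : ℝ} (hr : 0 < r) :
    HasDerivAt (deriv psi) (deriv (deriv psi) r) r :=
  (analyticAt_psi hr).deriv.differentiableAt.hasDerivAt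

lemma deriv_psi {r : ℝ} (hr : 0 < r) :
    deriv psi r = 2 * r * logQuot r + r ^ 2 * deriv logQuot r := by
  have := ((hasDerivAt_id r).pow 2).mul (hasDerivAt_logQuot hr)
  refine this.deriv.trans ?_
  simp

lemma deriv_psi_of_ne {r : ℝ} (hr : 0 < r) (h1 : r ≠ 1) :
    deriv psi r = r * ((r - 1) * ((r - 1) ^ 2 - 2 * logRem r)) / (r - 1) ^ 4 := by
  have h2 : r - 1 ≠ 0 := sub_ne_zero.2 h1
  have h3 := logQuot_ode hr
  rw [deriv_psi hr, eq_div_iff (pow_ne_zero 4 h2), ← sq_mul_logQuot r]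
  linear_combination r * (r - 1) ^ 3 * h3

lemma deriv_deriv_psi_of_ne {r : ℝ} (hr : 0 < r) (h1 : r ≠ 1) :
    deriv (deriv psi) r =
      (2 * (1 + 2 * r) * logRem r - 3 * (r - 1) ^ 2) / (r - 1) ^ 4 := by
  have h2 : r - 1 ≠ 0 := sub_ne_zero.2 h1
  have hev : deriv psi =ᶠ[nhds r]
      fun r => r * ((r - 1) * ((r - 1) ^ 2 - 2 * logRem r)) / (r - 1) ^ 4 := by
    filter_upwards [isOpen_ne.mem_nhds h1, lt_mem_nhds hr] with s hs hs0
      using deriv_psi_of_ne hs0 hs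
  rw [hev.deriv_eq]
  have hs := (hasDerivAt_id r).sub_const 1
  have hd := ((hasDerivAt_id r).mul (hs.mul ((hs.pow 2).sub
    ((hasDerivAt_logRem hr).const_mul 2)))).div (hs.pow 4) (pow_ne_zero 4 h2)
  refine hd.deriv.trans ?_
  simp
  field_simp
  ring

lemma deriv_psi_nonneg {r : ℝ} (hr : 0 < r) : 0 ≤ deriv psi r := by
  have off : ∀ s, 0 < s → s ≠ 1 → 0 ≤ deriv psi s := fun s hs h1 => by
    rw [deriv_psi_of_ne hs h1]
    exact div_nonneg (mul_nonneg hs.le (logRem_cubic_nonneg hs)) (by positivity)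
  rcases eq_or_ne r 1 with rfl | h1
  · refine nonneg_of_punctured (hasDerivAt_deriv_psi one_pos).continuousAt ?_
    filter_upwards [eventually_punctured_pos one_pos] with s hs using off s hs.1 hs.2
  · exact off r hr h1

lemma deriv_deriv_psi_nonneg {r : ℝ} (hr : 0 < r) : 0 ≤ deriv (deriv psi) r := by
  have off : ∀ s, 0 < s → s ≠ 1 → 0 ≤ deriv (deriv psi) s := fun s hs h1 => by
    rw [deriv_deriv_psi_of_ne hs h1]
    exact div_nonneg (by linarith [pade_le_logRem hs]) (by positivity)
  rcases eq_or_ne r 1 with rfl | h1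
  · refine nonneg_of_punctured (analyticAt_psi one_pos).deriv.deriv.continuousAt ?_
    filter_upwards [eventually_punctured_pos one_pos] with s hs using off s hs.1 hs.2
  · exact off r hr h1

namespace IsEvenWave

variable {L ω : ℝ} {φ : ℝ → ℝ}

/-! ### The profile -/

/-- The potential of `𝓛₊` on the line. -/
def linePlus (ω : ℝ) (φ : ℝ → ℝ) (x : ℝ) : ℝ :=
  1 + (ω - 1) * ((1 + φ x ^ 2) / (1 - φ x ^ 2) ^ 2)

/-- The potential of `𝓛₋` on the line. -/
def lineMinus (ω : ℝ) (φ : ℝ → ℝ) (x : ℝ) : ℝ := 1 + (ω - 1) * (1 / (1 - φ x ^ 2))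

lemma one_sub_sq_pos (h : IsEvenWave L ω φ) (x : ℝ) : 0 < 1 - φ x ^ 2 := by
  nlinarith [h.pos x, h.lt_one x]

lemma continuous (h : IsEvenWave L ω φ) : Continuous φ := h.contDiff.continuous

lemma continuous_linePlus (h : IsEvenWave L ω φ) : Continuous (linePlus ω φ) := by
  have := h.continuous
  have h2 := fun x => (pow_pos (h.one_sub_sq_pos x) 2).ne'
  unfold linePlus
  fun_prop (disch := assumption)

lemma hasDerivAt (h : IsEvenWave L ω φ) (x : ℝ) : HasDerivAt φ (deriv φ x) x :=
  ((h.contDiff.differentiable (by norm_num)) x).hasDerivAt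

lemma hasDerivAt_deriv (h : IsEvenWave L ω φ) (x : ℝ) :
    HasDerivAt (deriv φ) (lineMinus ω φ x * φ x) x := by
  have h1 : ContDiff ℝ 1 (deriv φ) :=
    ((contDiff_succ_iff_deriv (n := 1)).1 (by simpa [one_add_one_eq_two] using h.contDiff)).2.2
  refine ((h1.differentiable (by norm_num)) x).hasDerivAt.congr_deriv ?_
  have h2 := h.ode x
  have h3 := (h.one_sub_sq_pos x).ne'
  rw [lineMinus]
  field_simp
  linear_combination -h2

/-- `𝓛₋ φ = 0`. -/
lemma isSol_profile (h : IsEvenWave L ω φ) : IsSol (lineMinus ω φ) φ (deriv φ) :=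
  ⟨h.hasDerivAt, h.hasDerivAt_deriv⟩

/-- `𝓛₊ φ' = 0`. -/
lemma isSol_deriv (h : IsEvenWave L ω φ) :
    IsSol (linePlus ω φ) (deriv φ) (fun x => lineMinus ω φ x * φ x) := by
  refine ⟨h.hasDerivAt_deriv, fun x => ?_⟩
  have h3 := (h.one_sub_sq_pos x).ne'
  have h4 : HasDerivAt (fun x => 1 - φ x ^ 2) (-(2 * φ x * deriv φ x)) x := by
    simpa using ((h.hasDerivAt x).pow 2).const_sub 1
  have h5 : HasDerivAt (lineMinus ω φ)
      ((ω - 1) * (2 * φ x * deriv φ x / (1 - φ x ^ 2) ^ 2)) x := by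
    have h6 := (((h4.inv h3)).const_mul (ω - 1)).const_add 1
    simp only [← one_div] at h6
    exact h6.congr_deriv (by ring)
  refine (h5.mul (h.hasDerivAt x)).congr_deriv ?_
  rw [linePlus, lineMinus]
  field_simp
  ring

lemma exists_deriv_ne_zero (h : IsEvenWave L ω φ) [hL : Fact (0 < L)] : ∃ x, deriv φ x ≠ 0 := by
  by_contra hno
  push Not at hno
  have hL := hL.out
  refine h.minimal (L / 2) (by linarith) (by linarith) fun x => ?_
  exact is_const_of_deriv_eq_zero (h.contDiff.differentiable (by norm_num)) hno _ _

/-- φ' solves a linear second-order equation, so a double zero would make it vanish identically. -/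
lemma second_deriv_ne_zero (h : IsEvenWave L ω φ) [Fact (0 < L)] {y : ℝ}
    (hy : deriv φ y = 0) : lineMinus ω φ y * φ y ≠ 0 := fun h0 => by
  obtain ⟨x, hx⟩ := h.exists_deriv_ne_zero
  exact hx (h.isSol_deriv.eq_zero h.continuous_linePlus hy h0 x).1

/-- The profile is symmetric about each of its critical points. -/
lemma even_of_deriv_eq_zero (h : IsEvenWave L ω φ) {y : ℝ} (hy : deriv φ y = 0) (x : ℝ) :
    φ (2 * y - x) = φ x := by
  have hd : ∀ x : ℝ, HasDerivAt (fun x => 2 * y - x) (-1) x := fun x => by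
    simpa using (hasDerivAt_id x).const_sub (2 * y)
  -- This is the difference quotient of s ↦ s - (1 - ω)s/(1 - s²) between the two values, so the
  -- difference of φ and its reflection solves a linear equation with zero data at y.
  set b : ℝ → ℝ := fun x => 1 + (ω - 1) * ((1 + φ (2 * y - x) * φ x) /
    ((1 - φ (2 * y - x) ^ 2) * (1 - φ x ^ 2))) with hb
  have hc : Continuous b := by
    have := h.continuous
    have h2 := fun x => (mul_pos (h.one_sub_sq_pos (2 * y - x)) (h.one_sub_sq_pos x)).ne'
    fun_prop (disch := assumption)
  have hsol : IsSol b (fun x => φ (2 * y - x) - φ x)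
      (fun x => -deriv φ (2 * y - x) - deriv φ x) := by
    refine ⟨fun x => ?_, fun x => ?_⟩
    · exact (((h.hasDerivAt (2 * y - x)).comp x (hd x)).sub (h.hasDerivAt x)).congr_deriv (by ring)
    · refine ((((h.hasDerivAt_deriv (2 * y - x)).comp x (hd x)).neg).sub
        (h.hasDerivAt_deriv x)).congr_deriv ?_
      have h1 := (h.one_sub_sq_pos x).ne'
      have h2 := (h.one_sub_sq_pos (2 * y - x)).ne'
      simp only [hb, lineMinus]
      field_simp
      ring
  have h1 := (hsol.eq_zero hc (y := y) (by simp [two_mul]) (by simp [two_mul, hy]) x).1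
  exact sub_eq_zero.1 h1

lemma deriv_reflect (h : IsEvenWave L ω φ) {y : ℝ} (hy : ∀ x, φ (2 * y - x) = φ x) (x : ℝ) :
    deriv φ (2 * y - x) = -deriv φ x := by
  have hd : HasDerivAt (fun x => 2 * y - x) (-1) x := by
    simpa using (hasDerivAt_id x).const_sub (2 * y)
  have h1 := (h.hasDerivAt (2 * y - x)).comp x hd
  rw [show φ ∘ (fun x => 2 * y - x) = φ from funext hy] at h1
  linarith [h1.unique (h.hasDerivAt x)]

lemma deriv_eq_zero_of_even (h : IsEvenWave L ω φ) {y : ℝ} (hy : ∀ x, φ (2 * y - x) = φ x) :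
    deriv φ y = 0 := by
  have := h.deriv_reflect hy y
  rw [show 2 * y - y = y by ring] at this
  linarith

lemma even_half_period (h : IsEvenWave L ω φ) {y : ℝ} (hy : ∀ x, φ (2 * y - x) = φ x) (x : ℝ) :
    φ (2 * (y + L / 2) - x) = φ x := by
  rw [show 2 * (y + L / 2) - x = 2 * y - x + L by ring, h.periodic, hy]

/-- A critical point z would be a second symmetry point, and composing the two reflections gives the
period 2(z - y) < L. -/
lemma deriv_ne_zero_of_mem (h : IsEvenWave L ω φ) {y : ℝ} (hy : ∀ x, φ (2 * y - x) = φ x) {z : ℝ}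
    (hz : y < z) (hz' : z < y + L / 2) : deriv φ z ≠ 0 := fun h0 => by
  refine h.minimal (2 * (z - y)) (by linarith) (by linarith) fun x => ?_
  rw [show x + 2 * (z - y) = 2 * z - (2 * y - x) by ring, h.even_of_deriv_eq_zero h0, hy]

/-- The profile has a symmetry point from which it decreases during half a period. -/
lemma exists_max (h : IsEvenWave L ω φ) [hL : Fact (0 < L)] :
    ∃ a, (∀ x, φ (2 * a - x) = φ x) ∧ ∀ x, a < x → x < a + L / 2 → deriv φ x < 0 := by
  have hL := hL.out
  obtain ⟨x₀, hx₀⟩ := h.even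
  have he : ∀ x, φ (2 * x₀ - x) = φ x := fun x => by
    have := hx₀ (x₀ - x)
    rw [show x₀ + (x₀ - x) = 2 * x₀ - x by ring, sub_sub_cancel] at this
    exact this
  have hc : Continuous (deriv φ) := h.isSol_profile.continuous'
  have hsign : ∀ y z, (∀ x, φ (2 * y - x) = φ x) → y < z → z < y + L / 2 → deriv φ z < 0 →
      ∀ x, y < x → x < y + L / 2 → deriv φ x < 0 := fun y z hy hz hz' hneg x hx hx' => by
    by_contra hpos
    obtain ⟨t, ht, ht0⟩ := (isPreconnected_Ioo (a := y) (b := y + L / 2)).intermediate_value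
      ⟨hz, hz'⟩ ⟨hx, hx'⟩ hc.continuousOn ⟨hneg.le, not_lt.1 hpos⟩
    exact h.deriv_ne_zero_of_mem hy ht.1 ht.2 ht0
  have hm := h.deriv_ne_zero_of_mem he (z := x₀ + L / 4) (by linarith) (by linarith)
  rcases lt_or_gt_of_ne hm with hlt | hgt
  · exact ⟨x₀, he, hsign x₀ _ he (by linarith) (by linarith) hlt⟩
  -- If the profile rises after x₀, then x₀ is a minimum, and the symmetry point half a period later
  -- is the maximum.
  · have he' := h.even_half_period he
    refine ⟨x₀ + L / 2, he', hsign _ (x₀ + L / 2 + L / 4) he' (by linarith) (by linarith) ?_⟩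
    rw [show x₀ + L / 2 + L / 4 = 2 * (x₀ + L / 2) - (x₀ + L / 4) by ring, h.deriv_reflect he']
    linarith

/-! ### The even solution of `𝓛₊ u = 0` -/

/-- The variable `(1 - φ²) / (1 - ω)`. -/
def ratio (ω : ℝ) (φ : ℝ → ℝ) (x : ℝ) : ℝ := (1 - φ x ^ 2) / (1 - ω)

lemma one_sub_omega_pos (h : IsEvenWave L ω φ) : 0 < 1 - ω := by linarith [h.omega_lt]

lemma ratio_pos (h : IsEvenWave L ω φ) (x : ℝ) : 0 < ratio ω φ x :=
  div_pos (h.one_sub_sq_pos x) h.one_sub_omega_pos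

lemma sq_profile (h : IsEvenWave L ω φ) (x : ℝ) : φ x ^ 2 = 1 - (1 - ω) * ratio ω φ x := by
  have := h.one_sub_omega_pos.ne'
  rw [ratio]
  field_simp
  ring

lemma hasDerivAt_ratio (h : IsEvenWave L ω φ) (x : ℝ) :
    HasDerivAt (ratio ω φ) (-(2 * φ x * deriv φ x) / (1 - ω)) x := by
  have h4 : HasDerivAt (fun x => 1 - φ x ^ 2) (-(2 * φ x * deriv φ x)) x := by
    simpa using ((h.hasDerivAt x).pow 2).const_sub 1
  exact h4.div_const _

lemma continuous_ratio (h : IsEvenWave L ω φ) : Continuous (ratio ω φ) :=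
  continuous_iff_continuousAt.2 fun x => (h.hasDerivAt_ratio x).continuousAt

lemma lineMinus_eq (h : IsEvenWave L ω φ) (x : ℝ) :
    lineMinus ω φ x = -(1 - ratio ω φ x) / ratio ω φ x := by
  have h1 := h.one_sub_omega_pos.ne'
  have h2 := (h.one_sub_sq_pos x).ne'
  rw [ratio, lineMinus]
  field_simp
  ring

lemma linePlus_eq (h : IsEvenWave L ω φ) (x : ℝ) :
    linePlus ω φ x = -(2 - (1 - ω) * (ratio ω φ x + ratio ω φ x ^ 2)) /
      ((1 - ω) * ratio ω φ x ^ 2) := by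
  have h1 := h.one_sub_omega_pos.ne'
  have h2 := (h.one_sub_sq_pos x).ne'
  rw [ratio, linePlus]
  field_simp
  ring

/-- The rate of the coefficient of `φ'` in the even solution. -/
def shearRate (ω : ℝ) (φ : ℝ → ℝ) (x : ℝ) : ℝ :=
  (logQuot (ratio ω φ x) * (2 - (1 - ω) * (ratio ω φ x + ratio ω φ x ^ 2)) / φ x ^ 2 - 1) / 2

/-- The coefficient of `φ'` in the even solution. -/
def shear (ω : ℝ) (φ : ℝ → ℝ) (a x : ℝ) : ℝ := ∫ t in a..x, shearRate ω φ t

/-- The part of the even solution which is a function of `φ`. -/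
def evenPart (ω : ℝ) (φ : ℝ → ℝ) (x : ℝ) : ℝ :=
  (1 - ω) / 2 * (ratio ω φ x * (1 - ratio ω φ x) * logQuot (ratio ω φ x)) / φ x

lemma hasDerivAt_logQuot_ratio (h : IsEvenWave L ω φ) (x : ℝ) :
    HasDerivAt (fun x => logQuot (ratio ω φ x))
      (deriv logQuot (ratio ω φ x) * (-(2 * φ x * deriv φ x) / (1 - ω))) x :=
  (hasDerivAt_logQuot (h.ratio_pos x)).comp x (h.hasDerivAt_ratio x)

lemma hasDerivAt_shear (h : IsEvenWave L ω φ) (a x : ℝ) :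
    HasDerivAt (shear ω φ a) (shearRate ω φ x) x := by
  have hc : Continuous (shearRate ω φ) := by
    have h1 := h.continuous
    have h2 := h.continuous_ratio
    have h3 : Continuous fun x => logQuot (ratio ω φ x) :=
      continuous_iff_continuousAt.2 fun x => (h.hasDerivAt_logQuot_ratio x).continuousAt
    have h4 := fun x => (pow_pos (h.pos x) 2).ne'
    unfold shearRate
    fun_prop (disch := assumption)
  exact (hc.integral_hasStrictDerivAt a x).hasDerivAt

/-- In terms of the potential W, `evenPart` is W/W' and `shearRate` is WW''/W'² - 1/2, and (W/W')' =
1 - WW''/W'². Writing W/W' through `logQuot` removes the apparent singularity at the equilibrium r =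
1. -/
lemma hasDerivAt_evenPart (h : IsEvenWave L ω φ) (x : ℝ) :
    HasDerivAt (evenPart ω φ) ((1 / 2 - shearRate ω φ x) * deriv φ x) x := by
  have hr := h.hasDerivAt_ratio x
  have hd := (((hr.mul (hr.const_sub 1)).mul (h.hasDerivAt_logQuot_ratio x)).const_mul
    ((1 - ω) / 2)).div (h.hasDerivAt x) (h.pos x).ne'
  refine hd.congr_deriv ?_
  have h1 := h.one_sub_omega_pos.ne'
  have h2 := (h.pos x).ne'
  have h3 := logQuot_ode (h.ratio_pos x)
  have h4 := h.sq_profile x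
  simp only [Pi.mul_apply, shearRate]
  set r := ratio ω φ x
  set η := logQuot r
  set η' := deriv logQuot r
  set F := φ x
  set c := 1 - ω
  field_simp
  linear_combination deriv φ x * (2 * F ^ 2 * h3 - 2 * η * h4)

/-- Formally u is the energy times the derivative of the profile with respect to the energy: its
Wronskian u'φ' - uφ'' equals φ'²/2 - (W/W')φ'' = (φ'² + W)/2, half the conserved energy. -/
lemma isSol_even (h : IsEvenWave L ω φ) (a : ℝ) :
    IsSol (linePlus ω φ) (fun x => evenPart ω φ x + shear ω φ a x * deriv φ x)
      (fun x => deriv φ x / 2 + shear ω φ a x * (lineMinus ω φ x * φ x)) := by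
  refine ⟨fun x => ?_, fun x => ?_⟩
  · exact ((h.hasDerivAt_evenPart x).add ((h.hasDerivAt_shear a x).mul
      (h.hasDerivAt_deriv x))).congr_deriv (by ring)
  · refine (((h.hasDerivAt_deriv x).div_const 2).add ((h.hasDerivAt_shear a x).mul
      (h.isSol_deriv.deriv₂ x))).congr_deriv ?_
    suffices hs : (1 / 2 + shearRate ω φ x) * (lineMinus ω φ x * φ x) =
        linePlus ω φ x * evenPart ω φ x by linear_combination hs
    have h1 := h.one_sub_omega_pos.ne'
    have h2 := (h.pos x).ne'
    have h3 := (h.ratio_pos x).ne'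
    rw [h.lineMinus_eq, h.linePlus_eq, shearRate, evenPart]
    field_simp
    ring

/-- The identity 1 - 2WW''/W'² = W'(W/W'²)' together with W' = -2φ''. Having φ'' as a factor
prepares the integration by parts in `shear_neg`. -/
lemma two_mul_shearRate (h : IsEvenWave L ω φ) (x : ℝ) :
    2 * shearRate ω φ x = -((deriv psi (ratio ω φ x) / φ x +
      (1 - ω) * psi (ratio ω φ x) / φ x ^ 3) * (lineMinus ω φ x * φ x)) := by
  have h1 := h.one_sub_omega_pos.ne'
  have h2 := (h.pos x).ne'
  have h3 := logQuot_ode (h.ratio_pos x)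
  have h4 := h.sq_profile x
  have h5 := (h.ratio_pos x).ne'
  rw [shearRate, h.lineMinus_eq, deriv_psi (h.ratio_pos x), psi]
  set r := ratio ω φ x
  set η := logQuot r
  set η' := deriv logQuot r
  set F := φ x
  set c := 1 - ω
  field_simp
  linear_combination F ^ 2 * h3 - 2 * η * h4

/-- The period of the waves increases with their amplitude: the coefficient of `φ'` in the even
solution is negative after half a period. -/
lemma shear_neg (h : IsEvenWave L ω φ) [hL : Fact (0 < L)] {a : ℝ}
    (ha : ∀ x, φ (2 * a - x) = φ x)
    (hneg : ∀ x, a < x → x < a + L / 2 → deriv φ x < 0) :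
    shear ω φ a (a + L / 2) < 0 := by
  have hL := hL.out
  have hc := h.one_sub_omega_pos
  -- κ is 2s - 2φ'(W/W'²)': the φ'' terms cancel in its derivative, leaving -2φ'²(W/W'²)''. As φ'
  -- vanishes at both ends, κ equals 2s there.
  set κ : ℝ → ℝ := fun x => 2 * shear ω φ a x + (deriv psi (ratio ω φ x) / φ x +
    (1 - ω) * psi (ratio ω φ x) / φ x ^ 3) * deriv φ x with hκ
  have hd : ∀ x, HasDerivAt κ (-deriv φ x ^ 2 * (2 / (1 - ω)) *
      (deriv (deriv psi) (ratio ω φ x) + 3 / 2 * deriv psi (ratio ω φ x) * (1 - ω) / φ x ^ 2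
        + 3 / 2 * psi (ratio ω φ x) * (1 - ω) ^ 2 / (φ x ^ 2) ^ 2)) x := fun x => by
    have hr := h.ratio_pos x
    have h1 := (hasDerivAt_psi hr).comp x (h.hasDerivAt_ratio x)
    have h2 := (hasDerivAt_deriv_psi hr).comp x (h.hasDerivAt_ratio x)
    have h3 := (h.pos x).ne'
    have h4 := hc.ne'
    refine (((h.hasDerivAt_shear a x).const_mul 2).add (((h2.div (h.hasDerivAt x) h3).add
      ((h1.const_mul (1 - ω)).div ((h.hasDerivAt x).pow 3) (pow_ne_zero 3 h3))).mul
        (h.hasDerivAt_deriv x))).congr_deriv ?_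
    have h5 := h.two_mul_shearRate x
    simp only [Function.comp_apply, Pi.add_apply, Pi.div_apply, Pi.pow_apply]
    rw [h5]
    field_simp
    ring
  have hanti : StrictAntiOn κ (Set.Icc a (a + L / 2)) := by
    refine strictAntiOn_of_deriv_neg (convex_Icc _ _)
      (fun x _ => (hd x).continuousAt.continuousWithinAt) fun x hx => ?_
    rw [interior_Icc] at hx
    rw [(hd x).deriv]
    have h1 := hneg x hx.1 hx.2
    have h2 := h.pos x
    have h3 := deriv_psi_nonneg (h.ratio_pos x)
    have h4 := deriv_deriv_psi_nonneg (h.ratio_pos x)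
    have h5 := psi_pos (h.ratio_pos x)
    have h6 : 0 < deriv φ x ^ 2 := by nlinarith
    rw [neg_mul, neg_mul]
    refine neg_neg_of_pos (mul_pos (by positivity) ?_)
    have h7 : 0 < 3 / 2 * psi (ratio ω φ x) * (1 - ω) ^ 2 / (φ x ^ 2) ^ 2 := by positivity
    have h8 : 0 ≤ 3 / 2 * deriv psi (ratio ω φ x) * (1 - ω) / φ x ^ 2 := by positivity
    linarith
  have h1 := hanti (Set.left_mem_Icc.2 (by linarith)) (Set.right_mem_Icc.2 (by linarith))
    (show a < a + L / 2 by linarith)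
  simp only [hκ, h.deriv_eq_zero_of_even ha, h.deriv_eq_zero_of_even (h.even_half_period ha)] at h1
  have h2 : shear ω φ a a = 0 := intervalIntegral.integral_same
  rw [h2] at h1
  linarith

/-- The Sturm data of `𝓛₊`. -/
lemma exists_sturmData (h : IsEvenWave L ω φ) [hL : Fact (0 < L)] :
    ∃ a, (∀ x, linePlus ω φ (2 * a - x) = linePlus ω φ x) ∧ ∃ u u',
      SturmData (linePlus ω φ) (-deriv φ) (-fun x => lineMinus ω φ x * φ x) u u' a (a + L / 2) := by
  obtain ⟨a, ha, hneg⟩ := h.exists_max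
  have hL := hL.out
  have hda := h.deriv_eq_zero_of_even ha
  have hdb := h.deriv_eq_zero_of_even (h.even_half_period ha)
  have hab : a < a + L / 2 := by linarith
  have h2a : lineMinus ω φ a * φ a < 0 := by
    refine lt_of_le_of_ne (not_lt.1 fun hpos => ?_) (h.second_deriv_ne_zero hda)
    obtain ⟨c, hac, hcb, hc⟩ := eventually_pos_right (h.hasDerivAt_deriv a) hda hpos hab
    exact lt_asymm (hc c hac le_rfl) (hneg c hac hcb)
  have h2b : 0 < lineMinus ω φ (a + L / 2) * φ (a + L / 2) := by
    refine lt_of_le_of_ne ?_ (h.second_deriv_ne_zero hdb).symm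
    have h1 := deriv_nonpos_of_pos_left hab (h.hasDerivAt_deriv (a + L / 2)).neg (by simp [hdb])
      fun x hx hx' => by simpa using hneg x hx hx'
    linarith
  refine ⟨a, fun x => by rw [linePlus, ha, linePlus], _, _,
    ⟨hab, h.continuous_linePlus, h.isSol_deriv.neg, by simp [hda], by simp [hdb],
      fun x hx hx' => by simpa using hneg x hx hx', h.isSol_even a, ?_, ?_, ?_⟩⟩
  -- At the maximum φ'' < 0, which means r < 1; hence W/W', the value of u at a, is positive.
  · have h1 : 0 < 1 - ratio ω φ a := by
      have h3 := neg_of_mul_neg_left h2a (h.pos a).le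
      rw [h.lineMinus_eq, neg_div, neg_lt_zero] at h3
      exact (div_pos_iff_of_pos_right (h.ratio_pos a)).1 h3
    have h3 := h.one_sub_omega_pos
    have h4 := logQuot_pos (h.ratio_pos a)
    have h5 := h.ratio_pos a
    have h6 := h.pos a
    simp only [hda, mul_zero, add_zero, evenPart]
    positivity
  · simp [hda, shear]
  · simp only [hdb, zero_div, zero_add]
    exact mul_neg_of_neg_of_pos (h.shear_neg ha hneg) h2b

end IsEvenWave

/-! ### Operators with compact resolvent -/

section Eigenspaces

variable {X : Type*} [NormedAddCommGroup X] [NormedSpace ℂ X] {A B : X →ₗ.[ℂ] X} {z : ℂ}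

lemma mem_eigenspace {x : X} :
    x ∈ eigenspace A z ↔ ∃ u : A.domain, (u : X) = x ∧ A u = z • (u : X) := by
  simp only [eigenspace, Submodule.mem_map, LinearMap.mem_ker, LinearMap.sub_apply,
    LinearMap.smul_apply, Submodule.subtype_apply, sub_eq_zero]
  exact ⟨fun ⟨u, h1, h2⟩ => ⟨u, h2, h1⟩, fun ⟨u, h1, h2⟩ => ⟨u, h2, h1⟩⟩

lemma multiplicity_eq_zero_iff : multiplicity A z = 0 ↔ eigenspace A z = ⊥ := by
  rw [multiplicity, Cardinal.toENat_eq_zero, Submodule.rank_eq_zero]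

lemma multiplicity_ne_top [FiniteDimensional ℂ (eigenspace A z)] : multiplicity A z ≠ ⊤ := by
  rw [multiplicity, Ne, Cardinal.toENat_eq_top, not_le]
  exact Module.rank_lt_aleph0 ℂ _

lemma multiplicity_eq_one {x : X} (hx : x ≠ 0) (h : eigenspace A z = Submodule.span ℂ {x}) :
    multiplicity A z = 1 := by
  rw [multiplicity, h, ← Module.finrank_eq_rank, finrank_span_singleton hx]
  simp

lemma morseIndex_eq_zero (h : ∀ μ : ℝ, μ < 0 → multiplicity A (μ : ℂ) = 0) :
    morseIndex A = 0 := by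
  rw [morseIndex]
  simp_rw [fun μ : Set.Iio (0 : ℝ) => h μ μ.2]
  exact tsum_zero

lemma morseIndex_eq_of_unique {μ : ℝ} (hμ : μ < 0)
    (h : ∀ ν : ℝ, ν < 0 → ν ≠ μ → multiplicity A (ν : ℂ) = 0) :
    morseIndex A = multiplicity A (μ : ℂ) := by
  rw [morseIndex]
  exact tsum_eq_single (⟨μ, hμ⟩ : Set.Iio (0 : ℝ)) fun ν hν =>
    h ν ν.2 fun h0 => hν (Subtype.ext h0)

end Eigenspaces

/-! ### Spectral theory through a compact symmetric resolvent. -/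

section Hilbert

variable {X : Type*} [NormedAddCommGroup X] [InnerProductSpace ℂ X]

/-- `T` is the resolvent of `A` at `-l`. -/
structure IsResolvent (A : X →ₗ.[ℂ] X) (l : ℝ) (T : X →L[ℂ] X) : Prop where
  compact : IsCompactOperator T
  right : ∀ x, ∃ u : A.domain, (u : X) = T x ∧ A u + (l : ℂ) • (u : X) = x
  left : ∀ u : A.domain, T (A u + (l : ℂ) • (u : X)) = u

/-- A symmetric operator whose resolvents at large negative numbers are compact. -/
structure HasCompactResolvent (A : X →ₗ.[ℂ] X) : Prop where
  symm : ∀ u v : A.domain, inner ℂ (A u) (v : X) = inner ℂ (u : X) (A v)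
  exists_resolvent : ∃ M : ℝ, ∀ l : ℝ, M < l → ∃ T : X →L[ℂ] X, IsResolvent A l T

variable {A : X →ₗ.[ℂ] X} {T : X →L[ℂ] X} {l : ℝ} {z : ℂ}

/-- Keeping z + l as a multiplier, rather than inverting it, covers z = -l too, where both sides
force x = 0. -/
lemma IsResolvent.mem_eigenspace_iff (hT : IsResolvent A l T) {x : X} :
    x ∈ eigenspace A z ↔ (z + l) • T x = x := by
  rw [mem_eigenspace]
  constructor
  · rintro ⟨u, rfl, hu⟩
    have := hT.left u
    rwa [hu, ← add_smul, map_smul] at this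
  · intro hx
    obtain ⟨u, hu, hAu⟩ := hT.right x
    refine ⟨(z + l) • u, by rw [Submodule.coe_smul, hu, hx], ?_⟩
    rw [LinearPMap.map_smul, Submodule.coe_smul, smul_comm z]
    congr 1
    rw [← hu, add_smul] at hx
    exact add_right_cancel (hAu.trans hx.symm)

lemma IsResolvent.eigenspace_eq (hT : IsResolvent A l T) (hz : z + l ≠ 0) :
    eigenspace A z = Module.End.eigenspace (T : Module.End ℂ X) (z + l)⁻¹ := by
  ext x
  rw [hT.mem_eigenspace_iff, Module.End.mem_eigenspace_iff]
  exact (eq_inv_smul_iff₀ hz).symm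

lemma IsResolvent.hasEigenvalue_iff (hT : IsResolvent A l T) (hz : z + l ≠ 0) :
    Module.End.HasEigenvalue (T : Module.End ℂ X) (z + l)⁻¹ ↔ eigenspace A z ≠ ⊥ := by
  rw [hT.eigenspace_eq hz, Module.End.hasEigenvalue_iff]

/-- Fredholm alternative for the compact operator `T`: unless m = (z + l)⁻¹ is an eigenvalue of `T`,
m - T is invertible, and then m T(m - T)⁻¹ inverts A - z. For z = -l, `T` itself is the inverse. -/
lemma IsResolvent.eigenspace_ne_bot [CompleteSpace X] (hT : IsResolvent A l T)
    (hz : z ∈ spec A) : eigenspace A z ≠ ⊥ := fun h0 => hz <| by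
  rcases eq_or_ne (z + l) 0 with h1 | h1
  · have hzl : z = -(l : ℂ) := eq_neg_of_add_eq_zero_left h1
    subst hzl
    refine ⟨T, fun x => ?_, fun u => ?_⟩
    · obtain ⟨u, hu, hAu⟩ := hT.right x
      exact ⟨u, hu, by rw [neg_smul, sub_neg_eq_add, hAu]⟩
    · rw [neg_smul, sub_neg_eq_add, hT.left]
  · have h2 := (hT.compact.hasEigenvalue_or_mem_resolventSet (inv_ne_zero h1)).resolve_left
      (by rw [hT.hasEigenvalue_iff h1, not_not]; exact h0)
    obtain ⟨S, hS⟩ := h2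
    set m := (z + l)⁻¹ with hm
    have hmz : m * (z + l) = 1 := inv_mul_cancel₀ h1
    have hSx : ∀ x, (S : X →L[ℂ] X) x = m • x - T x := fun x => by
      rw [hS]
      simp [Algebra.algebraMap_eq_smul_one]
    have hSi : ∀ x, (S : X →L[ℂ] X) ((↑S⁻¹ : X →L[ℂ] X) x) = x := fun x => by
      rw [← mul_apply_eq_comp, S.mul_inv]; rfl
    have hiS : ∀ x, (↑S⁻¹ : X →L[ℂ] X) ((S : X →L[ℂ] X) x) = x := fun x => by
      rw [← mul_apply_eq_comp, S.inv_mul]; rfl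
    have key : ∀ w : X, w - (z + l) • T w = (z + l) • (S : X →L[ℂ] X) w := fun w => by
      rw [hSx, smul_sub, smul_smul, mul_comm, hmz, one_smul]
    refine ⟨m • (T * (↑S⁻¹ : X →L[ℂ] X)), fun x => ?_, fun u => ?_⟩
    · obtain ⟨u, hu, hAu⟩ := hT.right (m • (↑S⁻¹ : X →L[ℂ] X) x)
      refine ⟨u, by simpa using hu, ?_⟩
      have h3 : A u - z • (u : X) = (A u + (l : ℂ) • (u : X)) - (z + l) • (u : X) := by
        rw [add_smul]; abel
      rw [h3, hAu, hu, key, map_smul, hSi, smul_smul, mul_comm, hmz, one_smul]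
    · have h3 : A u - z • (u : X) = (A u + (l : ℂ) • (u : X)) -
          (z + l) • T (A u + (l : ℂ) • (u : X)) := by
        rw [hT.left, add_smul]; abel
      rw [h3, key]
      change m • T ((↑S⁻¹ : X →L[ℂ] X) _) = _
      rw [map_smul, hiS, map_smul, hT.left, smul_smul, hmz, one_smul]

namespace HasCompactResolvent

lemma isSymmetric (h : HasCompactResolvent A) (hT : IsResolvent A l T) :
    (T : X →ₗ[ℂ] X).IsSymmetric := fun x y => by
  obtain ⟨u, hu, hAu⟩ := hT.right x
  obtain ⟨v, hv, hAv⟩ := hT.right y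
  simp only [ContinuousLinearMap.coe_coe]
  rw [← hu, ← hv]
  nth_rw 1 [← hAv]
  nth_rw 1 [← hAu]
  rw [inner_add_right, inner_add_left, h.symm, inner_smul_right, inner_smul_left, Complex.conj_ofReal]

lemma eigenspace_ne_bot [CompleteSpace X] (h : HasCompactResolvent A) (hz : z ∈ spec A) :
    eigenspace A z ≠ ⊥ := by
  obtain ⟨M, hM⟩ := h.exists_resolvent
  obtain ⟨T, hT⟩ := hM (M + 1) (by linarith)
  exact hT.eigenspace_ne_bot hz

/-- A shift beyond any given radius. -/
lemma exists_shift (h : HasCompactResolvent A) (r : ℝ) :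
    ∃ l : ℝ, r < l ∧ 0 < l ∧ ∃ T : X →L[ℂ] X, IsResolvent A l T := by
  obtain ⟨M, hM⟩ := h.exists_resolvent
  refine ⟨max M (max r 0) + 1, ?_, ?_, hM _ ?_⟩
  · linarith [(le_max_left r 0).trans (le_max_right M _)]
  · linarith [(le_max_right r 0).trans (le_max_right M _)]
  · linarith [le_max_left M (max r 0)]

lemma add_shift_ne_zero {r : ℝ} (hz : ‖z‖ ≤ r) (hl : r < l) (h0 : 0 < l) : z + l ≠ 0 := by
  intro h1
  rw [eq_neg_of_add_eq_zero_left h1, norm_neg, Complex.norm_real, Real.norm_eq_abs,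
    abs_of_pos h0] at hz
  linarith

lemma finiteDimensional_eigenspace [CompleteSpace X] (h : HasCompactResolvent A) (z : ℂ) :
    FiniteDimensional ℂ (eigenspace A z) := by
  obtain ⟨l, hl, h0, T, hT⟩ := h.exists_shift ‖z‖
  have h1 := add_shift_ne_zero le_rfl hl h0
  rw [hT.eigenspace_eq h1]
  exact ContinuousLinearMap.finite_dimensional_eigenspace hT.compact _ (inv_ne_zero h1)

lemma exists_real (h : HasCompactResolvent A) (hz : eigenspace A z ≠ ⊥) :
    ∃ μ : ℝ, z = (μ : ℂ) := by
  obtain ⟨x, hx, hx0⟩ := Submodule.exists_mem_ne_zero_of_ne_bot hz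
  obtain ⟨u, rfl, hu⟩ := mem_eigenspace.1 hx
  have h1 := h.symm u u
  rw [hu, inner_smul_left, inner_smul_right] at h1
  have h2 := mul_right_cancel₀ (inner_self_ne_zero.2 hx0) h1
  obtain ⟨μ, hμ⟩ := Complex.conj_eq_iff_real.1 h2
  exact ⟨μ, hμ⟩

lemma inner_eq_zero_of_ne (h : HasCompactResolvent A) {z w : ℂ} (hzw : z ≠ w) {x y : X}
    (hx : x ∈ eigenspace A z) (hy : y ∈ eigenspace A w) : inner ℂ x y = 0 := by
  rcases eq_or_ne x 0 with rfl | hx0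
  · exact inner_zero_left _
  obtain ⟨μ, rfl⟩ := h.exists_real (z := z) (Submodule.ne_bot_iff _ |>.2 ⟨x, hx, hx0⟩)
  obtain ⟨u, rfl, hu⟩ := mem_eigenspace.1 hx
  obtain ⟨v, rfl, hv⟩ := mem_eigenspace.1 hy
  have h1 := h.symm u v
  rw [hu, hv, inner_smul_left, inner_smul_right, Complex.conj_ofReal] at h1
  exact (mul_eq_mul_right_iff.1 h1).resolve_left hzw

/-- A bounded set contains only finitely many eigenvalues. -/
lemma finite_eigenvalues (h : HasCompactResolvent A) (r : ℝ) :
    ({z | eigenspace A z ≠ ⊥} ∩ Metric.closedBall 0 r).Finite := by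
  by_contra hinf
  obtain ⟨l, hl, h0, T, hT⟩ := h.exists_shift r
  set f := Set.Infinite.natEmbedding _ hinf with hf
  have hne : ∀ n, eigenspace A (f n : ℂ) ≠ ⊥ := fun n => (f n).2.1
  have hnorm : ∀ n, ‖(f n : ℂ)‖ ≤ r := fun n => by simpa using (f n).2.2
  have hr : 0 ≤ r := (norm_nonneg _).trans (hnorm 0)
  have hex : ∀ n, ∃ x ∈ eigenspace A (f n : ℂ), ‖x‖ = 1 := fun n => by
    obtain ⟨x, hx, hx0⟩ := Submodule.exists_mem_ne_zero_of_ne_bot (hne n)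
    exact ⟨((‖x‖ : ℂ))⁻¹ • x, Submodule.smul_mem _ _ hx, norm_smul_inv_norm hx0⟩
  choose e he hen using hex
  have hTe : ∀ n, T (e n) = ((f n : ℂ) + l)⁻¹ • e n := fun n =>
    (eq_inv_smul_iff₀ (add_shift_ne_zero (hnorm n) hl h0)).2 (hT.mem_eigenspace_iff.1 (he n))
  -- Eigenvectors for distinct eigenvalues are orthogonal, so pairing the difference with e n
  -- isolates the eigenvalue (f n + l)⁻¹ of `T`. The separated images contradict compactness.
  have hsep : ∀ n m, n ≠ m → (r + l)⁻¹ ≤ ‖T (e n) - T (e m)‖ := fun n m hnm => by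
    have hfnm : (f n : ℂ) ≠ f m := fun h1 => hnm (f.injective (Subtype.ext h1))
    have h1 : inner ℂ (e n) (T (e n) - T (e m)) = ((f n : ℂ) + l)⁻¹ := by
      rw [hTe, hTe, inner_sub_right, inner_smul_right, inner_smul_right,
        h.inner_eq_zero_of_ne hfnm (he n) (he m), inner_self_eq_norm_sq_to_K, hen]
      simp
    calc (r + l)⁻¹ ≤ ‖((f n : ℂ) + l)⁻¹‖ := by
          rw [norm_inv]
          have h2 : ‖(f n : ℂ) + l‖ ≤ r + l := (norm_add_le _ _).trans (by
            rw [Complex.norm_real, Real.norm_eq_abs, abs_of_pos h0]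
            linarith [hnorm n])
          exact inv_anti₀ (norm_pos_iff.2 (add_shift_ne_zero (hnorm n) hl h0)) h2
      _ = ‖inner ℂ (e n) (T (e n) - T (e m))‖ := by rw [h1]
      _ ≤ ‖e n‖ * ‖T (e n) - T (e m)‖ := norm_inner_le_norm _ _
      _ = _ := by rw [hen, one_mul]
  obtain ⟨K, hK, hTK⟩ := hT.compact.image_closedBall_subset_compact (f := (T : X →ₗ[ℂ] X)) 1
  obtain ⟨y, -, ψ, hψ, hlim⟩ := hK.tendsto_subseq (x := fun n => T (e n)) fun n =>
    hTK ⟨e n, by simp [hen], rfl⟩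
  have hc := hlim.cauchySeq
  obtain ⟨N, hN⟩ := Metric.cauchySeq_iff.1 hc (r + l)⁻¹ (by positivity)
  have h1 := hN N le_rfl (N + 1) (Nat.le_succ N)
  rw [dist_eq_norm] at h1
  exact absurd (hsep (ψ N) (ψ (N + 1)) (hψ (Nat.lt_succ_self N)).ne) (not_le.2 h1)

/-- If the quadratic form takes a negative value, there is a negative eigenvalue. -/
lemma exists_neg_eigenvalue [CompleteSpace X] (h : HasCompactResolvent A) (u : A.domain)
    (hu : (inner ℂ (A u) (u : X)).re < 0) :
    ∃ μ : ℝ, μ < 0 ∧ eigenspace A (μ : ℂ) ≠ ⊥ := by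
  by_contra hno
  push Not at hno
  -- Without negative eigenvalues ‖T‖ ≤ 1/l, that is l‖u‖ ≤ ‖Au + lu‖. Squaring gives 0 ≤ ‖Au‖² + 2l
  -- Re⟨Au, u⟩, which fails for l beyond this threshold.
  obtain ⟨l, hl, h0, T, hT⟩ := h.exists_shift (‖A u‖ ^ 2 / (-2 * (inner ℂ (A u) (u : X)).re))
  have hspec : ∀ t ∈ spectrum ℂ T, ‖t‖ ≤ l⁻¹ := fun t ht => by
    rcases eq_or_ne t 0 with rfl | ht0
    · rw [norm_zero]; positivity
    have h1 := (hT.compact.hasEigenvalue_iff_mem_spectrum ht0).2 ht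
    have h2 : (t⁻¹ - l : ℂ) + l ≠ 0 := by simpa using ht0
    have h3 := (hT.hasEigenvalue_iff h2).1 (by simpa using h1)
    obtain ⟨μ, hμ⟩ := h.exists_real h3
    have h4 : 0 ≤ μ := by
      by_contra hneg
      exact h3 (by rw [hμ]; exact hno μ (not_le.1 hneg))
    have h5 : t = ((μ + l : ℝ) : ℂ)⁻¹ := by
      rw [sub_eq_iff_eq_add] at hμ
      rw [Complex.ofReal_add, ← hμ, inv_inv]
    rw [h5, norm_inv, Complex.norm_real, Real.norm_eq_abs, abs_of_pos (by linarith)]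
    exact inv_anti₀ h0 (by linarith)
  have hnorm : ‖T‖ ≤ l⁻¹ := by
    have h1 := T.spectralRadius_eq_nnnorm (h.isSymmetric hT).isSelfAdjoint
    have h2 : spectralRadius ℂ T ≤ ENNReal.ofReal l⁻¹ := by
      refine iSup₂_le fun t ht => ?_
      exact ENNReal.coe_le_coe.2 ((Real.le_toNNReal_iff_coe_le (by positivity)).2 (hspec t ht))
    rw [h1] at h2
    have h3 := ENNReal.toReal_mono ENNReal.ofReal_ne_top h2
    rwa [ENNReal.toReal_ofReal (by positivity)] at h3
  have h1 : ‖(u : X)‖ ≤ l⁻¹ * ‖A u + (l : ℂ) • (u : X)‖ := by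
    nth_rw 1 [← hT.left u]
    exact T.le_of_opNorm_le hnorm _
  have h2 : l * ‖(u : X)‖ ≤ ‖A u + (l : ℂ) • (u : X)‖ := by
    rwa [inv_mul_eq_div, le_div_iff₀ h0, mul_comm] at h1
  have h3 : ‖A u + (l : ℂ) • (u : X)‖ ^ 2 =
      ‖A u‖ ^ 2 + 2 * (l * (inner ℂ (A u) (u : X)).re) + (l * ‖(u : X)‖) ^ 2 := by
    rw [@norm_add_sq ℂ, inner_smul_right, norm_smul, Complex.norm_real, Real.norm_eq_abs,
      abs_of_pos h0]
    simp
  have h4 : (l * ‖(u : X)‖) ^ 2 ≤ ‖A u + (l : ℂ) • (u : X)‖ ^ 2 :=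
    pow_le_pow_left₀ (by positivity) h2 2
  rw [div_lt_iff₀ (by linarith)] at hl
  nlinarith

/-- Every spectral point is a real eigenvalue, so only the nonpositive real numbers outside `S` have
to be excluded. -/
lemma restIsDiscretePositive [CompleteSpace X] (h : HasCompactResolvent A) {S : Set ℂ}
    (hS : ∀ μ : ℝ, μ ≤ 0 → (μ : ℂ) ∉ S → eigenspace A (μ : ℂ) = ⊥) :
    RestIsDiscretePositive A S := by
  refine ⟨fun z hz => ?_, fun r => (h.finite_eigenvalues r).subset fun z hz =>
    ⟨h.eigenspace_ne_bot hz.1.1, hz.2⟩⟩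
  have h1 := h.eigenspace_ne_bot hz.1
  have := h.finiteDimensional_eigenspace z
  refine ⟨?_, fun h0 => h1 (multiplicity_eq_zero_iff.1 h0), multiplicity_ne_top⟩
  obtain ⟨μ, rfl⟩ := h.exists_real h1
  refine ⟨μ, ?_, rfl⟩
  by_contra hμ
  exact h1 (hS μ (not_lt.1 hμ) hz.2)

end HasCompactResolvent

end Hilbert

/-! ### Block-diagonal operators -/

section BlockDiag

variable {X : Type*} [NormedAddCommGroup X] [NormedSpace ℂ X] {A B : X →ₗ.[ℂ] X} {z : ℂ}

lemma mem_eigenspace_blockDiag {x : WithLp 2 (X × X)} :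
    x ∈ eigenspace (blockDiag A B) z ↔ x.fst ∈ eigenspace A z ∧ x.snd ∈ eigenspace B z := by
  simp only [mem_eigenspace]
  constructor
  · rintro ⟨u, rfl, hu⟩
    exact ⟨⟨⟨u.1.fst, u.2.1⟩, rfl, congrArg WithLp.fst hu⟩,
      ⟨⟨u.1.snd, u.2.2⟩, rfl, congrArg WithLp.snd hu⟩⟩
  · rintro ⟨⟨u, hu, hAu⟩, ⟨v, hv, hBv⟩⟩
    have h1 : x = WithLp.toLp 2 ((u : X), (v : X)) := by
      rw [hu, hv]
      rfl
    subst h1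
    refine ⟨⟨WithLp.toLp 2 ((u : X), (v : X)), u.2, v.2⟩, rfl, ?_⟩
    change WithLp.toLp 2 (A u, B v) = z • WithLp.toLp 2 ((u : X), (v : X))
    rw [hAu, hBv]
    rfl

/-- The eigenspace of a block-diagonal operator is the product of the eigenspaces. -/
def eigenspaceBlockDiagEquiv (A B : X →ₗ.[ℂ] X) (z : ℂ) :
    eigenspace (blockDiag A B) z ≃ₗ[ℂ] eigenspace A z × eigenspace B z where
  toFun x := (⟨x.1.fst, (mem_eigenspace_blockDiag.1 x.2).1⟩,
    ⟨x.1.snd, (mem_eigenspace_blockDiag.1 x.2).2⟩)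
  invFun p := ⟨WithLp.toLp 2 ((p.1 : X), (p.2 : X)), mem_eigenspace_blockDiag.2 ⟨p.1.2, p.2.2⟩⟩
  map_add' _ _ := rfl
  map_smul' _ _ := rfl
  left_inv _ := rfl
  right_inv _ := rfl

lemma multiplicity_blockDiag :
    multiplicity (blockDiag A B) z = multiplicity A z + multiplicity B z := by
  simp only [multiplicity]
  rw [(eigenspaceBlockDiagEquiv A B z).rank_eq, rank_prod', map_add]

lemma inResolventSet_blockDiag (hA : InResolventSet A z) (hB : InResolventSet B z) :
    InResolventSet (blockDiag A B) z := by
  obtain ⟨R, hR1, hR2⟩ := hA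
  obtain ⟨S, hS1, hS2⟩ := hB
  let e := WithLp.prodContinuousLinearEquiv 2 ℂ X X
  refine ⟨(e.symm : X × X →L[ℂ] WithLp 2 (X × X)).comp ((R.prodMap S).comp
    (e : WithLp 2 (X × X) →L[ℂ] X × X)), fun x => ?_, fun u => ?_⟩
  · obtain ⟨u, hu, hAu⟩ := hR1 x.fst
    obtain ⟨v, hv, hBv⟩ := hS1 x.snd
    refine ⟨⟨WithLp.toLp 2 ((u : X), (v : X)), u.2, v.2⟩, ?_, ?_⟩
    · change WithLp.toLp 2 ((u : X), (v : X)) = WithLp.toLp 2 (R x.fst, S x.snd)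
      rw [hu, hv]
    · change WithLp.toLp 2 (A u - z • (u : X), B v - z • (v : X)) = x
      rw [hAu, hBv]
      rfl
  · change WithLp.toLp 2 (R (A ⟨u.1.fst, u.2.1⟩ - z • u.1.fst),
      S (B ⟨u.1.snd, u.2.2⟩ - z • u.1.snd)) = u.1
    rw [hR2 ⟨u.1.fst, u.2.1⟩, hS2 ⟨u.1.snd, u.2.2⟩]
    rfl

lemma spec_blockDiag_subset : spec (blockDiag A B) ⊆ spec A ∪ spec B := fun z hz => by
  by_contra hno
  rw [Set.mem_union, not_or] at hno
  exact hz (inResolventSet_blockDiag (not_not.1 hno.1) (not_not.1 hno.2))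

/-- A point may lie in the spectrum of one block only, so finite multiplicity is required of both
blocks at every z. -/
lemma RestIsDiscretePositive.blockDiag {S : Set ℂ} (hA : RestIsDiscretePositive A S)
    (hB : RestIsDiscretePositive B S) (hfA : ∀ z, multiplicity A z ≠ ⊤)
    (hfB : ∀ z, multiplicity B z ≠ ⊤) : RestIsDiscretePositive (blockDiag A B) S := by
  have hsub : spec (PeriodicNLS.blockDiag A B) \ S ⊆ (spec A \ S) ∪ (spec B \ S) := fun z hz =>
    (spec_blockDiag_subset hz.1).imp (fun h => ⟨h, hz.2⟩) fun h => ⟨h, hz.2⟩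
  refine ⟨fun z hz => ?_, fun r => ((hA.2 r).union (hB.2 r)).subset fun z hz =>
    (hsub hz.1).imp (fun h => ⟨h, hz.2⟩) fun h => ⟨h, hz.2⟩⟩
  rw [multiplicity_blockDiag]
  have h1 : multiplicity A z + multiplicity B z ≠ ⊤ := WithTop.add_ne_top.2 ⟨hfA z, hfB z⟩
  rcases hsub hz with h | h
  · exact ⟨(hA.1 z h).1, fun h0 => (hA.1 z h).2.1 (add_eq_zero.1 h0).1, h1⟩
  · exact ⟨(hB.1 z h).1, fun h0 => (hB.1 z h).2.1 (add_eq_zero.1 h0).2, h1⟩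

lemma RestIsDiscretePositive.mono {S S' : Set ℂ} (hA : RestIsDiscretePositive A S)
    (hS : S ⊆ S') : RestIsDiscretePositive A S' :=
  ⟨fun z hz => hA.1 z ⟨hz.1, fun h => hz.2 (hS h)⟩, fun r => (hA.2 r).subset fun _ hz =>
    ⟨⟨hz.1.1, fun h => hz.1.2 (hS h)⟩, hz.2⟩⟩

lemma eigenspace_blockDiag_eq_span {x y : X} (hA : eigenspace A z = Submodule.span ℂ {x})
    (hB : eigenspace B z = Submodule.span ℂ {y}) :
    eigenspace (blockDiag A B) z =
      Submodule.span ℂ {WithLp.toLp 2 (x, 0), WithLp.toLp 2 (0, y)} := by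
  ext p
  rw [mem_eigenspace_blockDiag, hA, hB, Submodule.mem_span_singleton,
    Submodule.mem_span_singleton, Submodule.mem_span_pair]
  constructor
  · rintro ⟨⟨a, ha⟩, ⟨b, hb⟩⟩
    refine ⟨a, b, ?_⟩
    change WithLp.toLp 2 (a • x + b • (0 : X), a • (0 : X) + b • y) = p
    rw [smul_zero, smul_zero, add_zero, zero_add, ha, hb]
    rfl
  · rintro ⟨a, b, rfl⟩
    exact ⟨⟨a, by simp⟩, ⟨b, by simp⟩⟩

end BlockDiag

/-! ### Schrödinger operators on the circle have compact resolvent -/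

section Circle

/-- The symbol `(2πk/L)²` of `-∂ₓ²`. -/
def symbol (L : ℝ) (k : ℤ) : ℝ := (2 * Real.pi * k / L) ^ 2

lemma symbol_nonneg {L : ℝ} (k : ℤ) : 0 ≤ symbol L k := sq_nonneg _

variable {L : ℝ} [Fact (0 < L)]

lemma inner_fourierBasis (k : ℤ) (f : L2per L) :
    inner ℂ (fourierBasis k : L2per L) f = fourierCoeff f k := by
  rw [← fourierBasis_repr, HilbertBasis.repr_apply_apply]

lemma ext_fourierCoeff {f g : L2per L} (h : ∀ k, fourierCoeff f k = fourierCoeff g k) : f = g := by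
  refine fourierBasis.repr.injective (lp.ext (funext fun k => ?_))
  rw [fourierBasis_repr, fourierBasis_repr, h]

lemma fourierCoeff_sub (f g : L2per L) (k : ℤ) :
    fourierCoeff (f - g : L2per L) k = fourierCoeff f k - fourierCoeff g k := by
  simp only [← inner_fourierBasis, inner_sub_right]

lemma inner_eq_tsum (f g : L2per L) :
    inner ℂ f g = ∑' k, (starRingEnd ℂ) (fourierCoeff f k) * fourierCoeff g k := by
  rw [← fourierBasis.repr.inner_map_map, lp.inner_eq_tsum]
  refine tsum_congr fun k => ?_
  rw [fourierBasis_repr, fourierBasis_repr, RCLike.inner_apply, mul_comm]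

lemma norm_sq_eq_tsum (f : L2per L) : ‖f‖ ^ 2 = ∑' k, ‖fourierCoeff f k‖ ^ 2 := by
  have h := lp.norm_rpow_eq_tsum (p := 2) (by norm_num) (fourierBasis.repr f)
  rw [LinearIsometryEquiv.norm_map] at h
  simpa [fourierBasis_repr] using h

lemma summable_sq_fourierCoeff (f : L2per L) : Summable fun k => ‖fourierCoeff f k‖ ^ 2 := by
  have h := (lp.memℓp (fourierBasis.repr f)).summable (by norm_num)
  simpa [fourierBasis_repr] using h

lemma fourierCoeff_secondDeriv (u : Hper L 2) (k : ℤ) :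
    fourierCoeff (secondDeriv u) k = -(symbol L k : ℂ) * fourierCoeff u.1 k := by
  rw [← fourierBasis_repr]
  change fourierBasis.repr (fourierBasis.repr.symm _) k = _
  rw [LinearIsometryEquiv.apply_symm_apply]
  simp only [symbol, Complex.ofReal_pow]

lemma summable_inv_one_add_sq : Summable fun k : ℤ => (1 + (k : ℝ) ^ 2)⁻¹ := by
  have h : Summable fun k : ℤ => 1 / (k : ℝ) ^ 2 :=
    Real.summable_one_div_int_pow.2 (by norm_num)
  refine h.of_norm_bounded_eventually ?_
  filter_upwards [(Set.finite_singleton (0 : ℤ)).compl_mem_cofinite] with k hk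
  have hk' : (k : ℝ) ≠ 0 := Int.cast_ne_zero.2 hk
  rw [norm_inv, Real.norm_of_nonneg (by positivity), ← one_div]
  exact one_div_le_one_div_of_le (by positivity) (by linarith)

/-- Trades the multiplier of -∂² + l for the Sobolev weight 1 + k², both for summability and for
membership in H². -/
lemma exists_le_symbol_add {l : ℝ} (hl : 0 < l) :
    ∃ c > 0, ∀ k : ℤ, c * (1 + (k : ℝ) ^ 2) ≤ symbol L k + l := by
  have hL : 0 < L := Fact.out
  refine ⟨min ((2 * Real.pi / L) ^ 2) l, lt_min (by positivity) hl, fun k => ?_⟩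
  have h1 : symbol L k = (2 * Real.pi / L) ^ 2 * (k : ℝ) ^ 2 := by rw [symbol]; ring
  have h2 : min ((2 * Real.pi / L) ^ 2) l * (k : ℝ) ^ 2 ≤
      (2 * Real.pi / L) ^ 2 * (k : ℝ) ^ 2 := by
    gcongr
    exact min_le_left _ _
  rw [h1, mul_add, mul_one]
  linarith [min_le_right ((2 * Real.pi / L) ^ 2) l]

lemma mem_Hper_two {f : L2per L} :
    f ∈ Hper L 2 ↔ Summable fun k : ℤ => (1 + (k : ℝ) ^ 2) ^ 2 * ‖fourierCoeff f k‖ ^ 2 := by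
  change Summable (fun k : ℤ => (1 + (k : ℝ) ^ 2) ^ (2 : ℝ) * ‖fourierCoeff f k‖ ^ 2) ↔ _
  simp_rw [Real.rpow_two]

/-- The rank-one projection onto a Fourier mode. -/
def modeProj (k : ℤ) : L2per L →L[ℂ] L2per L :=
  (innerSL ℂ (fourierBasis k : L2per L)).smulRight (fourierBasis k : L2per L)

lemma modeProj_apply (k : ℤ) (f : L2per L) :
    modeProj k f = fourierCoeff f k • (fourierBasis k : L2per L) := by
  rw [modeProj, ContinuousLinearMap.smulRight_apply, innerSL_apply_apply, inner_fourierBasis]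

lemma norm_modeProj_le (k : ℤ) : ‖(modeProj k : L2per L →L[ℂ] L2per L)‖ ≤ 1 := by
  rw [modeProj, ContinuousLinearMap.norm_smulRight_apply, innerSL_apply_norm,
    fourierBasis.orthonormal.1 k, one_mul]

lemma isCompactOperator_modeProj (k : ℤ) :
    IsCompactOperator (modeProj k : L2per L →L[ℂ] L2per L) := by
  have h1 : IsCompactOperator (innerSL ℂ (fourierBasis k : L2per L)) :=
    isCompactOperator_of_locallyCompactSpace_dom _
  exact h1.clm_comp (ContinuousLinearMap.toSpanSingleton ℂ (fourierBasis k : L2per L))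

variable (L) in
/-- The resolvent `(-∂ₓ² + l)⁻¹`. -/
def freeResolvent (l : ℝ) : L2per L →L[ℂ] L2per L :=
  ∑' k : ℤ, ((symbol L k + l : ℝ) : ℂ)⁻¹ • modeProj k

/-- The series converges in operator norm, dominated by ∑ 1/(1 + k²); its sum is therefore a norm
limit of finite-rank operators, hence compact. -/
lemma hasSum_freeResolvent {l : ℝ} (hl : 0 < l) :
    HasSum (fun k : ℤ => ((symbol L k + l : ℝ) : ℂ)⁻¹ • (modeProj k : L2per L →L[ℂ] L2per L))
      (freeResolvent L l) := by
  refine Summable.hasSum ?_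
  obtain ⟨c, hc, hle⟩ := exists_le_symbol_add (L := L) hl
  refine (summable_inv_one_add_sq.mul_left c⁻¹).of_norm_bounded fun k => ?_
  have h1 := symbol_nonneg (L := L) k
  rw [norm_smul, norm_inv, Complex.norm_real, Real.norm_of_nonneg (by positivity), ← mul_inv]
  calc (symbol L k + l)⁻¹ * ‖(modeProj k : L2per L →L[ℂ] L2per L)‖ ≤ (symbol L k + l)⁻¹ * 1 := by
        gcongr
        exact norm_modeProj_le k
    _ ≤ _ := by
        rw [mul_one]
        exact inv_anti₀ (by positivity) (hle k)

lemma fourierCoeff_freeResolvent {l : ℝ} (hl : 0 < l) (f : L2per L) (k : ℤ) :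
    fourierCoeff (freeResolvent L l f) k = ((symbol L k + l : ℝ) : ℂ)⁻¹ * fourierCoeff f k := by
  have h1 := ((hasSum_freeResolvent hl).mapL (ContinuousLinearMap.apply ℂ (L2per L) f)).mapL
    (innerSL ℂ (fourierBasis k : L2per L))
  have h2 := hasSum_single (f := fun j : ℤ => innerSL ℂ (fourierBasis k : L2per L)
    ((ContinuousLinearMap.apply ℂ (L2per L) f)
      (((symbol L j + l : ℝ) : ℂ)⁻¹ • (modeProj j : L2per L →L[ℂ] L2per L)))) k fun j hj => by
    simp only [ContinuousLinearMap.apply_apply, smul_apply, modeProj_apply,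
      innerSL_apply_apply, inner_smul_right]
    rw [fourierBasis.orthonormal.2 hj.symm, mul_zero, mul_zero]
  have h3 := h1.unique h2
  simp only [ContinuousLinearMap.apply_apply, smul_apply, modeProj_apply,
    innerSL_apply_apply, inner_smul_right] at h3
  rw [inner_fourierBasis, inner_self_eq_norm_sq_to_K, fourierBasis.orthonormal.1 k] at h3
  simpa using h3

lemma isCompactOperator_freeResolvent {l : ℝ} (hl : 0 < l) :
    IsCompactOperator (freeResolvent L l) := by
  refine isCompactOperator_of_tendsto (hasSum_freeResolvent hl) (Filter.Eventually.of_forall ?_)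
  intro s
  induction s using Finset.induction_on with
  | empty => simpa using isCompactOperator_zero
  | insert k s hk ih =>
    rw [Finset.sum_insert hk]
    exact ((isCompactOperator_modeProj k).smul _).add ih

lemma freeResolvent_mem {l : ℝ} (hl : 0 < l) (f : L2per L) : freeResolvent L l f ∈ Hper L 2 := by
  rw [mem_Hper_two]
  obtain ⟨c, hc, hle⟩ := exists_le_symbol_add (L := L) hl
  refine Summable.of_nonneg_of_le (fun k => by positivity) (fun k => ?_)
    ((summable_sq_fourierCoeff f).mul_left ((c⁻¹) ^ 2))
  have h1 := symbol_nonneg (L := L) k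
  rw [fourierCoeff_freeResolvent hl, norm_mul, norm_inv, Complex.norm_real,
    Real.norm_of_nonneg (by positivity), mul_pow, ← mul_assoc, ← mul_pow]
  gcongr
  rw [← div_eq_mul_inv, div_le_iff₀ (by positivity), inv_mul_eq_div, le_div_iff₀ hc, mul_comm]
  exact hle k

lemma freeResolvent_right {l : ℝ} (hl : 0 < l) (f : L2per L) :
    -secondDeriv ⟨freeResolvent L l f, freeResolvent_mem hl f⟩ + (l : ℂ) • freeResolvent L l f
      = f := by
  refine ext_fourierCoeff fun k => ?_
  have h1 := symbol_nonneg (L := L) k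
  have h2 : ((symbol L k + l : ℝ) : ℂ) ≠ 0 := Complex.ofReal_ne_zero.2 (by positivity)
  rw [neg_add_eq_sub, fourierCoeff_sub, fourierCoeff_smul, fourierCoeff_secondDeriv,
    fourierCoeff_freeResolvent hl, neg_mul, sub_neg_eq_add, ← add_mul, ← Complex.ofReal_add,
    add_comm l, mul_inv_cancel_left₀ h2]

lemma freeResolvent_left {l : ℝ} (hl : 0 < l) (u : Hper L 2) :
    freeResolvent L l (-secondDeriv u + (l : ℂ) • (u : L2per L)) = u := by
  refine ext_fourierCoeff fun k => ?_
  have h1 := symbol_nonneg (L := L) k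
  have h2 : ((symbol L k + l : ℝ) : ℂ) ≠ 0 := Complex.ofReal_ne_zero.2 (by positivity)
  rw [fourierCoeff_freeResolvent hl, neg_add_eq_sub, fourierCoeff_sub, fourierCoeff_smul,
    fourierCoeff_secondDeriv, neg_mul, sub_neg_eq_add, ← add_mul, ← Complex.ofReal_add,
    add_comm l, inv_mul_cancel_left₀ h2]

lemma norm_freeResolvent_le {l : ℝ} (hl : 0 < l) : ‖freeResolvent L l‖ ≤ l⁻¹ := by
  refine ContinuousLinearMap.opNorm_le_bound _ (by positivity) fun f => ?_
  refine (pow_le_pow_iff_left₀ (norm_nonneg _) (by positivity) two_ne_zero).1 ?_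
  rw [norm_sq_eq_tsum, mul_pow, norm_sq_eq_tsum, ← tsum_mul_left]
  refine (summable_sq_fourierCoeff _).tsum_le_tsum (fun k => ?_)
    ((summable_sq_fourierCoeff f).mul_left _)
  have h1 := symbol_nonneg (L := L) k
  rw [fourierCoeff_freeResolvent hl, norm_mul, norm_inv, Complex.norm_real,
    Real.norm_of_nonneg (by positivity), mul_pow]
  gcongr
  linarith

lemma norm_mulPotential_le (V : C(AddCircle L, ℝ)) (f : L2per L) :
    ‖mulPotential V f‖ ≤ ‖V‖ * ‖f‖ := by
  refine Lp.norm_le_mul_norm_of_ae_le_mul ?_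
  filter_upwards [(memLp_mul V f).coeFn_toLp] with x hx
  change ‖((memLp_mul V f).toLp _ : L2per L) x‖ ≤ _
  rw [hx, norm_mul, Complex.norm_real]
  gcongr
  exact V.norm_coe_le_norm x

/-- Multiplication by a potential as a bounded operator. -/
def mulPotentialL (V : C(AddCircle L, ℝ)) : L2per L →L[ℂ] L2per L :=
  (mulPotential V).mkContinuous ‖V‖ (norm_mulPotential_le V)

lemma schrodinger_apply (V : C(AddCircle L, ℝ)) (u : (schrodinger V).domain) :
    schrodinger V u = -secondDeriv u + mulPotential V u := rfl

/-- Factor -∂² + V + l = (1 + VR)(-∂² + l) with R = (-∂² + l)⁻¹. Since ‖VR‖ ≤ ‖V‖/l < 1, the first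
factor is invertible by a Neumann series, and R(1 + VR)⁻¹ is compact because R is. -/
lemma exists_isResolvent_schrodinger (V : C(AddCircle L, ℝ)) {l : ℝ} (hl : ‖V‖ < l) :
    ∃ T : L2per L →L[ℂ] L2per L, IsResolvent (schrodinger V) l T := by
  have h0 : 0 < l := (norm_nonneg V).trans_lt hl
  set R := freeResolvent L l with hR
  set M := mulPotentialL V with hM
  have hnorm : ‖-(M * R)‖ < 1 := by
    rw [norm_neg]
    calc ‖M * R‖ ≤ ‖M‖ * ‖R‖ := norm_mul_le _ _
      _ ≤ ‖V‖ * l⁻¹ := by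
        gcongr
        · exact LinearMap.mkContinuous_norm_le _ (norm_nonneg _) _
        · exact norm_freeResolvent_le h0
      _ < 1 := by rwa [← div_eq_mul_inv, div_lt_one h0]
  obtain ⟨S, hS⟩ := isUnit_one_sub_of_norm_lt_one hnorm
  rw [sub_neg_eq_add] at hS
  have hSx : ∀ x, (S : L2per L →L[ℂ] L2per L) x = x + mulPotential V (R x) := fun x => by
    rw [hS]
    rfl
  have hSi : ∀ x, (S : L2per L →L[ℂ] L2per L) ((↑S⁻¹ : L2per L →L[ℂ] L2per L) x) = x :=
    fun x => by
      rw [← mul_apply_eq_comp, S.mul_inv]; rfl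
  have hiS : ∀ x, (↑S⁻¹ : L2per L →L[ℂ] L2per L) ((S : L2per L →L[ℂ] L2per L) x) = x :=
    fun x => by
      rw [← mul_apply_eq_comp, S.inv_mul]; rfl
  refine ⟨R * (↑S⁻¹ : L2per L →L[ℂ] L2per L),
    (isCompactOperator_freeResolvent h0).comp_clm _, fun x => ?_, fun u => ?_⟩
  · set y := (↑S⁻¹ : L2per L →L[ℂ] L2per L) x with hy
    refine ⟨⟨R y, freeResolvent_mem h0 y⟩, rfl, ?_⟩
    rw [schrodinger_apply, add_right_comm]
    have h1 := freeResolvent_right h0 y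
    refine (congrArg (· + mulPotential V (R y)) h1).trans ?_
    rw [← hSx, hy, hSi]
  · set w := -secondDeriv u + (l : ℂ) • (u : L2per L) with hw
    have h1 : R w = u := freeResolvent_left h0 u
    have h2 : schrodinger V u + (l : ℂ) • (u : L2per L) = (S : L2per L →L[ℂ] L2per L) w := by
      rw [hSx, h1, hw, schrodinger_apply, add_right_comm]
    rw [h2, mul_apply_eq_comp, hiS, h1]

lemma inner_mulPotential (V : C(AddCircle L, ℝ)) (f g : L2per L) :
    inner ℂ (mulPotential V f) g = inner ℂ f (mulPotential V g) := by
  rw [L2.inner_def, L2.inner_def]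
  refine integral_congr_ae ?_
  filter_upwards [(memLp_mul V f).coeFn_toLp, (memLp_mul V g).coeFn_toLp] with x hx hy
  change inner ℂ (((memLp_mul V f).toLp _ : L2per L) x) (g x) =
    inner ℂ (f x) (((memLp_mul V g).toLp _ : L2per L) x)
  rw [hx, hy]
  simp only [RCLike.inner_apply, map_mul, Complex.conj_ofReal]
  ring

lemma inner_secondDeriv (u v : Hper L 2) :
    inner ℂ (secondDeriv u) (v : L2per L) = inner ℂ (u : L2per L) (secondDeriv v) := by
  rw [inner_eq_tsum, inner_eq_tsum]
  refine tsum_congr fun k => ?_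
  rw [fourierCoeff_secondDeriv, fourierCoeff_secondDeriv, map_mul, map_neg, Complex.conj_ofReal]
  ring

lemma hasCompactResolvent_schrodinger (V : C(AddCircle L, ℝ)) :
    HasCompactResolvent (schrodinger V) := by
  refine ⟨fun u v => ?_, ‖V‖, fun l hl => exists_isResolvent_schrodinger V hl⟩
  rw [schrodinger_apply, schrodinger_apply, inner_add_left, inner_add_right, inner_mulPotential,
    inner_neg_left, inner_neg_right]
  congr 2
  exact inner_secondDeriv u v

end Circle

/-! ### Regularity of eigenfunctions -/

section Regularity

lemma continuous_comp_coe {L : ℝ} {E : Type*} [TopologicalSpace E] (F : C(AddCircle L, E)) :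
    Continuous fun y : ℝ => F (y : AddCircle L) :=
  F.continuous.comp (AddCircle.continuous_mk' L)

/-- A complex-valued periodic function as a function on the circle. -/
def liftCircle {L : ℝ} (f : ℝ → ℂ) (hf : Continuous f) (hp : Function.Periodic f L) :
    C(AddCircle L, ℂ) where
  toFun := hp.lift
  continuous_toFun := continuous_quot_lift _ hf

lemma liftCircle_coe {L : ℝ} (f : ℝ → ℂ) (hf : Continuous f) (hp : Function.Periodic f L) (x : ℝ) :
    liftCircle f hf hp (x : AddCircle L) = f x := hp.lift_coe x

variable {L : ℝ} [Fact (0 < L)]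

variable (L) in
/-- The class in `L²_per` of a continuous complex-valued function. -/
def classL2 : C(AddCircle L, ℂ) →L[ℂ] L2per L := ContinuousMap.toLp (E := ℂ) 2 haarAddCircle ℂ

lemma classL2_injective : Function.Injective (classL2 L) :=
  ContinuousMap.toLp_injective haarAddCircle

lemma coeFn_classL2 (F : C(AddCircle L, ℂ)) : classL2 L F =ᵐ[haarAddCircle] F :=
  ContinuousMap.coeFn_toLp haarAddCircle F

lemma fourierCoeff_classL2 (F : C(AddCircle L, ℂ)) (n : ℤ) :
    fourierCoeff (classL2 L F) n = fourierCoeff F n := fourierCoeff_toLp F n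

lemma fourierCoeff_add_smul (F G : C(AddCircle L, ℂ)) (c : ℂ) (n : ℤ) :
    fourierCoeff (F + c • G : C(AddCircle L, ℂ)) n = fourierCoeff F n + c * fourierCoeff G n := by
  simp only [← fourierCoeff_classL2, map_add, map_smul, fourierCoeff_add, fourierCoeff_smul]

/-- `F₁` is the derivative of the function `F` on the circle. -/
def IsDerivOn (F F₁ : C(AddCircle L, ℂ)) : Prop :=
  ∀ x : ℝ, HasDerivAt (fun y : ℝ => F (y : AddCircle L)) (F₁ (x : AddCircle L)) x

/-- Integration by parts over one period; the boundary terms cancel by periodicity. -/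
lemma fourierCoeff_of_isDerivOn {F F₁ : C(AddCircle L, ℂ)} (h : IsDerivOn F F₁) (n : ℤ) :
    fourierCoeff F₁ n = (2 * Real.pi * n / L : ℝ) * Complex.I * fourierCoeff F n := by
  have hL : 0 < L := Fact.out
  rw [fourierCoeff_eq_intervalIntegral _ n 0, fourierCoeff_eq_intervalIntegral _ n 0, zero_add]
  have hd : ∀ x : ℝ, HasDerivAt (fun y : ℝ => fourier (-n) (y : AddCircle L) * F (y : AddCircle L))
      (-((2 * Real.pi * n / L : ℝ) * Complex.I) *
        (fourier (-n) (x : AddCircle L) * F (x : AddCircle L)) +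
        fourier (-n) (x : AddCircle L) * F₁ (x : AddCircle L)) x := fun x =>
    ((hasDerivAt_fourier_neg L n x).mul (h x)).congr_deriv (by push_cast; ring)
  have hc1 : Continuous fun x : ℝ => fourier (-n) (x : AddCircle L) * F (x : AddCircle L) :=
    (continuous_comp_coe (fourier (-n))).mul (continuous_comp_coe F)
  have hc2 : Continuous fun x : ℝ => fourier (-n) (x : AddCircle L) * F₁ (x : AddCircle L) :=
    (continuous_comp_coe (fourier (-n))).mul (continuous_comp_coe F₁)
  have h1 := intervalIntegral.integral_eq_sub_of_hasDerivAt (a := 0) (b := L)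
    (fun x _ => hd x) (((hc1.const_mul _).add hc2).intervalIntegrable _ _)
  have h2 : ((L : ℝ) : AddCircle L) = ((0 : ℝ) : AddCircle L) := by
    rw [AddCircle.coe_period, AddCircle.coe_zero]
  rw [h2, sub_self, intervalIntegral.integral_add ((hc1.const_mul _).intervalIntegrable _ _)
    (hc2.intervalIntegrable _ _), intervalIntegral.integral_const_mul] at h1
  simp only [smul_eq_mul, Complex.real_smul]
  linear_combination ((1 / L : ℝ) : ℂ) * h1

lemma fourierCoeff_fourier_zero (n : ℤ) :
    fourierCoeff (fourier 0 : C(AddCircle L, ℂ)) n = if n = 0 then 1 else 0 := by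
  rw [fourierCoeff_fourier, Pi.single_apply]

/-- A function of mean zero on the circle has a primitive of mean zero. -/
lemma exists_primitive {G : C(AddCircle L, ℂ)} (hG : fourierCoeff G 0 = 0) :
    ∃ P : C(AddCircle L, ℂ), IsDerivOn P G ∧ fourierCoeff P 0 = 0 := by
  have hL : 0 < L := Fact.out
  have hGc := continuous_comp_coe G
  have hd : ∀ x : ℝ, HasDerivAt (fun y => ∫ t in (0 : ℝ)..y, G (t : AddCircle L))
      (G (x : AddCircle L)) x := fun x => (hGc.integral_hasStrictDerivAt 0 x).hasDerivAt
  have hp : Function.Periodic (fun y => ∫ t in (0 : ℝ)..y, G (t : AddCircle L)) L := fun x => by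
    have h1 := fourierCoeff_eq_intervalIntegral (T := L) G 0 x
    rw [hG] at h1
    simp only [neg_zero, fourier_zero, one_smul] at h1
    have h2 : ∫ t in x..x + L, G (t : AddCircle L) = 0 :=
      (smul_eq_zero.1 h1.symm).resolve_left (by positivity)
    simp only
    rw [← intervalIntegral.integral_add_adjacent_intervals (b := x)
      (hGc.intervalIntegrable _ _) (hGc.intervalIntegrable _ _), h2, add_zero]
  have hc : Continuous fun y => ∫ t in (0 : ℝ)..y, G (t : AddCircle L) :=
    continuous_iff_continuousAt.2 fun x => (hd x).continuousAt
  set P₀ := liftCircle _ hc hp with hP₀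
  -- Subtracting the mean allows a second integration that is again periodic.
  refine ⟨P₀ + (-fourierCoeff P₀ 0) • fourier 0, fun x => ?_, ?_⟩
  · have h1 : (fun y : ℝ => (P₀ + (-fourierCoeff P₀ 0) • fourier 0 : C(AddCircle L, ℂ))
        (y : AddCircle L)) =
        fun y => (∫ t in (0 : ℝ)..y, G (t : AddCircle L)) + -fourierCoeff P₀ 0 := by
      funext y
      rw [ContinuousMap.add_apply, ContinuousMap.smul_apply, fourier_zero, smul_eq_mul, mul_one,
        hP₀, liftCircle_coe]
    rw [h1]
    exact (hd x).add_const _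
  · rw [fourierCoeff_add_smul, fourierCoeff_fourier_zero, if_pos rfl]
    ring

lemma fourierCoeff_second {F F₁ F₂ : C(AddCircle L, ℂ)} (h₁ : IsDerivOn F F₁)
    (h₂ : IsDerivOn F₁ F₂) (n : ℤ) :
    fourierCoeff F₂ n = -(symbol L n : ℂ) * fourierCoeff F n := by
  rw [fourierCoeff_of_isDerivOn h₂, fourierCoeff_of_isDerivOn h₁, symbol]
  push_cast
  linear_combination (2 * Real.pi * n / L : ℂ) ^ 2 * fourierCoeff F n * Complex.I_sq

/-- Classes of twice differentiable functions belong to `H²_per`. -/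
lemma classL2_mem {F F₁ F₂ : C(AddCircle L, ℂ)} (h₁ : IsDerivOn F F₁) (h₂ : IsDerivOn F₁ F₂) :
    classL2 L F ∈ Hper L 2 := by
  rw [mem_Hper_two]
  obtain ⟨c, hc, hle⟩ := exists_le_symbol_add (L := L) one_pos
  refine Summable.of_nonneg_of_le (fun k => by positivity) (fun k => ?_)
    ((summable_sq_fourierCoeff (classL2 L F - classL2 L F₂)).mul_left (c⁻¹ ^ 2))
  have h3 := symbol_nonneg (L := L) k
  have h4 : fourierCoeff (classL2 L F - classL2 L F₂ : L2per L) k =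
      ((symbol L k + 1 : ℝ) : ℂ) * fourierCoeff F k := by
    rw [fourierCoeff_sub, fourierCoeff_classL2, fourierCoeff_classL2, fourierCoeff_second h₁ h₂]
    push_cast
    ring
  have h5 : 1 + (k : ℝ) ^ 2 ≤ c⁻¹ * (symbol L k + 1) := by
    rw [inv_mul_eq_div, le_div_iff₀ hc, mul_comm]
    exact hle k
  rw [h4, fourierCoeff_classL2, norm_mul, Complex.norm_real, Real.norm_of_nonneg (by positivity),
    mul_pow, ← mul_assoc, ← mul_pow c⁻¹]
  gcongr

lemma secondDeriv_classL2 {F F₁ F₂ : C(AddCircle L, ℂ)} (h₁ : IsDerivOn F F₁)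
    (h₂ : IsDerivOn F₁ F₂) : secondDeriv ⟨classL2 L F, classL2_mem h₁ h₂⟩ = classL2 L F₂ :=
  ext_fourierCoeff fun k => by
    rw [fourierCoeff_secondDeriv, fourierCoeff_classL2, fourierCoeff_classL2,
      fourierCoeff_second h₁ h₂]

/-- Functions in `H²_per` are continuous. -/
lemma exists_continuous_of_mem {f : L2per L} (hf : f ∈ Hper L 2) :
    ∃ F : C(AddCircle L, ℂ), f = classL2 L F := by
  rw [mem_Hper_two] at hf
  have hs : Summable fun k : ℤ => ‖fourierCoeff f k‖ := by
    refine Summable.of_nonneg_of_le (fun k => norm_nonneg _) (fun k => ?_)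
      (hf.add summable_inv_one_add_sq)
    have h1 : 1 ≤ 1 + (k : ℝ) ^ 2 := by nlinarith [sq_nonneg (k : ℝ)]
    have h2 : (1 + (k : ℝ) ^ 2)⁻¹ ≤ 1 := inv_le_one_of_one_le₀ h1
    have h3 : (1 + (k : ℝ) ^ 2) * (1 + (k : ℝ) ^ 2)⁻¹ = 1 := mul_inv_cancel₀ (by positivity)
    have h4 : 0 < (1 + (k : ℝ) ^ 2)⁻¹ := by positivity
    -- With weight w = 1 + k², 2‖c‖ ≤ w²‖c‖² + w⁻² and w⁻² ≤ w⁻¹, so the coefficients are absolutely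
    -- summable.
    nlinarith [sq_nonneg ((1 + (k : ℝ) ^ 2) * ‖fourierCoeff f k‖ - (1 + (k : ℝ) ^ 2)⁻¹),
      norm_nonneg (fourierCoeff f k)]
  have hs2 : Summable fun k : ℤ => fourierCoeff f k • (fourier k : C(AddCircle L, ℂ)) := by
    refine Summable.of_norm ?_
    simpa only [norm_smul, fourier_norm, mul_one] using hs
  refine ⟨∑' k : ℤ, fourierCoeff f k • (fourier k : C(AddCircle L, ℂ)), ?_⟩
  have h1 := hs2.hasSum.mapL (classL2 L)
  simp only [map_smul] at h1
  exact (hasSum_fourier_series_L2 f).unique h1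

/-- Functions in `H²_per` whose second derivative is continuous are twice differentiable. -/
lemma exists_deriv_of_secondDeriv {u : Hper L 2} {F G : C(AddCircle L, ℂ)}
    (hF : (u : L2per L) = classL2 L F) (hG : secondDeriv u = classL2 L G) :
    ∃ F₁, IsDerivOn F F₁ ∧ IsDerivOn F₁ G := by
  have hL : 0 < L := Fact.out
  have hcoef : ∀ n, fourierCoeff G n = -(symbol L n : ℂ) * fourierCoeff F n := fun n => by
    rw [← fourierCoeff_classL2, ← hG, fourierCoeff_secondDeriv, hF, fourierCoeff_classL2]
  obtain ⟨P, hP, hP0⟩ := exists_primitive (G := G) (by rw [hcoef]; simp [symbol])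
  obtain ⟨H, hH, -⟩ := exists_primitive hP0
  -- F and the double primitive H of G agree in every mode n ≠ 0, where the symbol is invertible;
  -- only the constant mode needs correcting.
  have hFH : F = H + (fourierCoeff F 0 - fourierCoeff H 0) • fourier 0 := by
    refine classL2_injective (ext_fourierCoeff fun n => ?_)
    rw [fourierCoeff_classL2, fourierCoeff_classL2, fourierCoeff_add_smul,
      fourierCoeff_fourier_zero]
    by_cases hn : n = 0
    · subst hn
      simp
    · rw [if_neg hn, mul_zero, add_zero]
      have h1 := hcoef n
      rw [fourierCoeff_second hH hP] at h1
      have h2 : (symbol L n : ℂ) ≠ 0 := by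
        rw [Complex.ofReal_ne_zero, symbol]
        have : (n : ℝ) ≠ 0 := Int.cast_ne_zero.2 hn
        have := Real.pi_ne_zero
        have := hL.ne'
        positivity
      exact (mul_left_cancel₀ (neg_ne_zero.2 h2) h1).symm
  refine ⟨P, fun x => ?_, hP⟩
  rw [hFH]
  simp only [ContinuousMap.add_apply, ContinuousMap.smul_apply, fourier_zero]
  exact (hH x).add_const _

/-- The product of a real potential and a complex function. -/
def potMul (V : C(AddCircle L, ℝ)) (F : C(AddCircle L, ℂ)) : C(AddCircle L, ℂ) where
  toFun x := (V x : ℂ) * F x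
  continuous_toFun := by fun_prop

lemma mulPotential_classL2 (V : C(AddCircle L, ℝ)) (F : C(AddCircle L, ℂ)) :
    mulPotential V (classL2 L F) = classL2 L (potMul V F) := by
  refine Lp.ext ?_
  filter_upwards [(memLp_mul V (classL2 L F)).coeFn_toLp, coeFn_classL2 F,
    coeFn_classL2 (potMul V F)] with x h1 h2 h3
  change ((memLp_mul V (classL2 L F)).toLp _ : L2per L) x = _
  rw [h1, h2, h3]
  rfl

/-- Eigenfunctions are twice differentiable solutions of the eigenvalue equation. -/
lemma exists_of_mem_eigenspace {V : C(AddCircle L, ℝ)} {z : ℂ} {f : L2per L}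
    (hf : f ∈ eigenspace (schrodinger V) z) :
    ∃ F F₁, f = classL2 L F ∧ IsDerivOn F F₁ ∧ IsDerivOn F₁ (potMul V F - z • F) := by
  obtain ⟨u, rfl, hu⟩ := mem_eigenspace.1 hf
  obtain ⟨F, hF⟩ := exists_continuous_of_mem u.2
  have h1 : secondDeriv u = classL2 L (potMul V F - z • F) := by
    rw [schrodinger_apply] at hu
    rw [map_sub, map_smul, ← mulPotential_classL2, ← hF, ← hu]
    abel
  obtain ⟨F₁, h2, h3⟩ := exists_deriv_of_secondDeriv hF h1
  exact ⟨F, F₁, hF, h2, h3⟩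

/-- Twice differentiable functions belong to the domain of a Schrödinger operator, which acts on
them by the classical formula. -/
lemma exists_domain_classL2 (V : C(AddCircle L, ℝ)) {F F₁ F₂ : C(AddCircle L, ℂ)}
    (h₁ : IsDerivOn F F₁) (h₂ : IsDerivOn F₁ F₂) :
    ∃ u : (schrodinger V).domain, (u : L2per L) = classL2 L F ∧
      schrodinger V u = classL2 L (potMul V F - F₂) := by
  refine ⟨⟨classL2 L F, classL2_mem h₁ h₂⟩, rfl, ?_⟩
  rw [schrodinger_apply, map_sub, ← mulPotential_classL2, sub_eq_neg_add]
  exact congrArg (fun g : L2per L => -g + mulPotential V (classL2 L F)) (secondDeriv_classL2 h₁ h₂)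

end Regularity

/-! ### The spectra of `𝓛₊`, `𝓛₋` and the Hessian -/

section Transfer

/-- A real function on the circle, viewed as a complex function. -/
def complexify {L : ℝ} (G : C(AddCircle L, ℝ)) : C(AddCircle L, ℂ) where
  toFun x := (G x : ℂ)
  continuous_toFun := by fun_prop

variable {L : ℝ}

lemma IsDerivOn.isSol_re {V : C(AddCircle L, ℝ)} {q : ℝ → ℝ} {μ : ℝ} {F F₁ : C(AddCircle L, ℂ)}
    (hV : ∀ x : ℝ, V (x : AddCircle L) = q x) (h₁ : IsDerivOn F F₁)
    (h₂ : IsDerivOn F₁ (potMul V F - (μ : ℂ) • F)) :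
    IsSol (fun x => q x - μ) (fun x : ℝ => (F (x : AddCircle L)).re)
      (fun x : ℝ => (F₁ (x : AddCircle L)).re) := by
  refine ⟨fun x => Complex.reCLM.hasFDerivAt.comp_hasDerivAt x (h₁ x), fun x => ?_⟩
  refine (Complex.reCLM.hasFDerivAt.comp_hasDerivAt x (h₂ x)).congr_deriv ?_
  simp [potMul, hV]
  ring

lemma IsDerivOn.isSol_im {V : C(AddCircle L, ℝ)} {q : ℝ → ℝ} {μ : ℝ} {F F₁ : C(AddCircle L, ℂ)}
    (hV : ∀ x : ℝ, V (x : AddCircle L) = q x) (h₁ : IsDerivOn F F₁)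
    (h₂ : IsDerivOn F₁ (potMul V F - (μ : ℂ) • F)) :
    IsSol (fun x => q x - μ) (fun x : ℝ => (F (x : AddCircle L)).im)
      (fun x : ℝ => (F₁ (x : AddCircle L)).im) := by
  refine ⟨fun x => Complex.imCLM.hasFDerivAt.comp_hasDerivAt x (h₁ x), fun x => ?_⟩
  refine (Complex.imCLM.hasFDerivAt.comp_hasDerivAt x (h₂ x)).congr_deriv ?_
  simp [potMul, hV]
  ring

lemma periodic_comp_coe {E : Type*} (f : AddCircle L → E) :
    Function.Periodic (fun x : ℝ => f (x : AddCircle L)) L := fun x => by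
  simp only [AddCircle.coe_add_period]

lemma isDerivOn_complexify {G G₁ : C(AddCircle L, ℝ)}
    (h : ∀ x : ℝ, HasDerivAt (fun y : ℝ => G (y : AddCircle L)) (G₁ (x : AddCircle L)) x) :
    IsDerivOn (complexify G) (complexify G₁) := fun x => (h x).ofReal_comp

variable [Fact (0 < L)]

lemma toL2per_eq (G : C(AddCircle L, ℝ)) : toL2per G = classL2 L (complexify G) := rfl

/-- Real and imaginary parts of an eigenfunction with real eigenvalue. -/
lemma exists_real_solutions {V : C(AddCircle L, ℝ)} {q : ℝ → ℝ} {μ : ℝ} {f : L2per L}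
    (hV : ∀ x : ℝ, V (x : AddCircle L) = q x) (hf : f ∈ eigenspace (schrodinger V) (μ : ℂ)) :
    ∃ (F : C(AddCircle L, ℂ)) (v' w' : ℝ → ℝ), f = classL2 L F ∧
      IsSol (fun x => q x - μ) (fun x : ℝ => (F (x : AddCircle L)).re) v' ∧
      IsSol (fun x => q x - μ) (fun x : ℝ => (F (x : AddCircle L)).im) w' := by
  obtain ⟨F, F₁, hF, h₁, h₂⟩ := exists_of_mem_eigenspace hf
  exact ⟨F, _, _, hF, h₁.isSol_re hV h₂, h₁.isSol_im hV h₂⟩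

lemma eq_smul_of_re_im {F : C(AddCircle L, ℂ)} {G : C(AddCircle L, ℝ)} {c d : ℝ}
    (hre : ∀ x : ℝ, (F (x : AddCircle L)).re = c * G (x : AddCircle L))
    (him : ∀ x : ℝ, (F (x : AddCircle L)).im = d * G (x : AddCircle L)) :
    classL2 L F = (⟨c, d⟩ : ℂ) • toL2per G := by
  rw [toL2per_eq, ← map_smul]
  congr 1
  ext x
  induction x using QuotientAddGroup.induction_on with
  | H x =>
    refine Complex.ext ?_ ?_
    · simpa [complexify] using hre x
    · simpa [complexify] using him x

lemma mem_eigenspace_zero {V : C(AddCircle L, ℝ)} {F F₁ : C(AddCircle L, ℂ)}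
    (h₁ : IsDerivOn F F₁) (h₂ : IsDerivOn F₁ (potMul V F)) :
    classL2 L F ∈ eigenspace (schrodinger V) 0 := by
  obtain ⟨u, hu, hAu⟩ := exists_domain_classL2 V h₁ h₂
  exact mem_eigenspace.2 ⟨u, hu, by rw [hAu, sub_self, map_zero, zero_smul]⟩

lemma toL2per_ne_zero {G : C(AddCircle L, ℝ)} {x : AddCircle L} (hx : G x ≠ 0) :
    toL2per G ≠ 0 := fun h0 => by
  rw [toL2per_eq, ← map_zero (classL2 L)] at h0
  have := DFunLike.congr_fun (classL2_injective h0) x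
  exact hx (by simpa [complexify] using this)

lemma integral_pos_of_pos {G : C(AddCircle L, ℝ)} (hG : ∀ x, 0 < G x) :
    0 < ∫ x, G x ∂(haarAddCircle (T := L)) := by
  rw [integral_pos_iff_support_of_nonneg (fun x => (hG x).le)
    (G.continuous.integrable_of_hasCompactSupport (HasCompactSupport.of_compactSpace _))]
  have : Function.support G = Set.univ := Set.eq_univ_of_forall fun x => (hG x).ne'
  rw [this]
  simp

end Transfer

/-! ### Kernels and negative eigenvalues of the two operators of the wave. -/

namespace IsEvenWave

variable {L ω : ℝ} {φ : ℝ → ℝ}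

lemma profile_coe (h : IsEvenWave L ω φ) (x : ℝ) : h.profile (x : AddCircle L) = φ x :=
  h.periodic.lift_coe x

lemma profileDeriv_coe (h : IsEvenWave L ω φ) (x : ℝ) :
    h.profileDeriv (x : AddCircle L) = deriv φ x :=
  h.periodic_deriv.lift_coe x

lemma potentialPlus_coe (h : IsEvenWave L ω φ) (x : ℝ) :
    h.potentialPlus (x : AddCircle L) = linePlus ω φ x := by
  change 1 + (ω - 1) * ((1 + h.profile x ^ 2) / (1 - h.profile x ^ 2) ^ 2) = _
  rw [h.profile_coe, linePlus]

lemma potentialMinus_coe (h : IsEvenWave L ω φ) (x : ℝ) :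
    h.potentialMinus (x : AddCircle L) = lineMinus ω φ x := by
  change 1 + (ω - 1) * (1 / (1 - h.profile x ^ 2)) = _
  rw [h.profile_coe, lineMinus]

lemma isDerivOn_profile (h : IsEvenWave L ω φ) :
    IsDerivOn (complexify h.profile) (complexify h.profileDeriv) :=
  isDerivOn_complexify fun x => by
    simp only [h.profile_coe, h.profileDeriv_coe]
    exact h.hasDerivAt x

lemma isDerivOn_profileDeriv (h : IsEvenWave L ω φ) :
    IsDerivOn (complexify h.profileDeriv) (potMul h.potentialMinus (complexify h.profile)) := by
  have h1 := isDerivOn_complexify (G := h.profileDeriv) (G₁ := h.potentialMinus * h.profile)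
    fun x => by
      simp only [ContinuousMap.mul_apply, h.profile_coe, h.profileDeriv_coe, h.potentialMinus_coe]
      exact h.hasDerivAt_deriv x
  have h2 : complexify (h.potentialMinus * h.profile) =
      potMul h.potentialMinus (complexify h.profile) := by
    ext x
    simp [complexify, potMul]
  rwa [h2] at h1

lemma isDerivOn_second (h : IsEvenWave L ω φ) :
    IsDerivOn (potMul h.potentialMinus (complexify h.profile))
      (potMul h.potentialPlus (complexify h.profileDeriv)) := by
  have h1 := isDerivOn_complexify (G := h.potentialMinus * h.profile)
    (G₁ := h.potentialPlus * h.profileDeriv) fun x => by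
      simp only [ContinuousMap.mul_apply, h.profile_coe, h.profileDeriv_coe, h.potentialMinus_coe,
        h.potentialPlus_coe]
      exact h.isSol_deriv.deriv₂ x
  have h2 : complexify (h.potentialMinus * h.profile) =
      potMul h.potentialMinus (complexify h.profile) := by
    ext x
    simp [complexify, potMul]
  have h3 : complexify (h.potentialPlus * h.profileDeriv) =
      potMul h.potentialPlus (complexify h.profileDeriv) := by
    ext x
    simp [complexify, potMul]
  rwa [h2, h3] at h1

variable [Fact (0 < L)]

lemma hasCompactResolvent_opPlus (h : IsEvenWave L ω φ) : HasCompactResolvent h.opPlus :=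
  hasCompactResolvent_schrodinger _

lemma hasCompactResolvent_opMinus (h : IsEvenWave L ω φ) : HasCompactResolvent h.opMinus :=
  hasCompactResolvent_schrodinger _

/-- `𝓛₋` has no negative eigenvalues. -/
lemma eigenspace_opMinus_neg (h : IsEvenWave L ω φ) {μ : ℝ} (hμ : μ < 0) :
    eigenspace h.opMinus (μ : ℂ) = ⊥ := by
  refine (Submodule.eq_bot_iff _).2 fun f hf => ?_
  obtain ⟨F, v', w', rfl, hv, hw⟩ := exists_real_solutions h.potentialMinus_coe hf
  have h1 := fun x => (h.isSol_profile.eq_const_mul_of_pos h.periodic h.pos Fact.out hμ.le hv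
    (periodic_comp_coe fun x => (F x).re)).2 hμ x
  have h2 := fun x => (h.isSol_profile.eq_const_mul_of_pos h.periodic h.pos Fact.out hμ.le hw
    (periodic_comp_coe fun x => (F x).im)).2 hμ x
  rw [eq_smul_of_re_im (G := h.profile) (c := 0) (d := 0) (by simpa using h1) (by simpa using h2)]
  exact zero_smul ℂ _

/-- The kernel of `𝓛₋` is spanned by the profile. -/
lemma eigenspace_opMinus_zero (h : IsEvenWave L ω φ) :
    eigenspace h.opMinus 0 = Submodule.span ℂ {toL2per h.profile} := by
  refine le_antisymm (fun f hf => ?_) ?_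
  · rw [← Complex.ofReal_zero] at hf
    obtain ⟨F, v', w', rfl, hv, hw⟩ := exists_real_solutions h.potentialMinus_coe hf
    obtain ⟨c, hc⟩ := (h.isSol_profile.eq_const_mul_of_pos h.periodic h.pos Fact.out le_rfl hv
      (periodic_comp_coe fun x => (F x).re)).1
    obtain ⟨d, hd⟩ := (h.isSol_profile.eq_const_mul_of_pos h.periodic h.pos Fact.out le_rfl hw
      (periodic_comp_coe fun x => (F x).im)).1
    rw [eq_smul_of_re_im (G := h.profile) (fun x => by rw [hc, h.profile_coe])
      (fun x => by rw [hd, h.profile_coe])]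
    exact Submodule.smul_mem _ _ (Submodule.mem_span_singleton_self _)
  · rw [Submodule.span_singleton_le_iff_mem]
    exact mem_eigenspace_zero h.isDerivOn_profile h.isDerivOn_profileDeriv

/-- The kernel of `𝓛₊` is spanned by the derivative of the profile. -/
lemma eigenspace_opPlus_zero (h : IsEvenWave L ω φ) :
    eigenspace h.opPlus 0 = Submodule.span ℂ {toL2per h.profileDeriv} := by
  refine le_antisymm (fun f hf => ?_) ?_
  · obtain ⟨a, hq, u, u', hS⟩ := h.exists_sturmData
    rw [← Complex.ofReal_zero] at hf
    obtain ⟨F, v', w', rfl, hv, hw⟩ := exists_real_solutions h.potentialPlus_coe hf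
    simp only [sub_zero] at hv hw
    obtain ⟨c, hc⟩ := hS.periodic_kernel rfl hq hv (periodic_comp_coe fun x => (F x).re)
    obtain ⟨d, hd⟩ := hS.periodic_kernel rfl hq hw (periodic_comp_coe fun x => (F x).im)
    rw [eq_smul_of_re_im (G := h.profileDeriv) (c := -c) (d := -d)
      (fun x => by rw [hc, h.profileDeriv_coe, Pi.neg_apply]; ring)
      (fun x => by rw [hd, h.profileDeriv_coe, Pi.neg_apply]; ring)]
    exact Submodule.smul_mem _ _ (Submodule.mem_span_singleton_self _)
  · rw [Submodule.span_singleton_le_iff_mem]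
    exact mem_eigenspace_zero h.isDerivOn_profileDeriv h.isDerivOn_second

/-- `𝓛₊` has a negative eigenvalue. -/
lemma exists_neg_eigenvalue_opPlus (h : IsEvenWave L ω φ) :
    ∃ μ : ℝ, μ < 0 ∧ eigenspace h.opPlus (μ : ℂ) ≠ ⊥ := by
  obtain ⟨u, hu, hAu⟩ := exists_domain_classL2 h.potentialPlus h.isDerivOn_profile
    h.isDerivOn_profileDeriv
  refine h.hasCompactResolvent_opPlus.exists_neg_eigenvalue u ?_
  change (inner ℂ (schrodinger h.potentialPlus u) (u : L2per L)).re < 0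
  -- Since 𝓛₋φ = 0, 𝓛₊φ is the difference of the potentials times φ, so ⟨𝓛₊φ, φ⟩ = -∫ W with W > 0.
  set W : C(AddCircle L, ℝ) := (h.potentialMinus - h.potentialPlus) * h.profile ^ 2 with hW
  have hWpos : ∀ x, 0 < W x := fun x => by
    induction x using QuotientAddGroup.induction_on with
    | H x =>
      have h1 : W (x : AddCircle L) = (1 - ω) * (2 * φ x ^ 2 / (1 - φ x ^ 2) ^ 2) * φ x ^ 2 := by
        have h2 := (h.one_sub_sq_pos x).ne'
        simp only [hW, ContinuousMap.mul_apply, ContinuousMap.sub_apply, ContinuousMap.pow_apply,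
          h.profile_coe, h.potentialMinus_coe, h.potentialPlus_coe, linePlus, lineMinus]
        field_simp
        ring
      have h3 := h.one_sub_omega_pos
      have h4 := h.pos x
      have h5 := h.one_sub_sq_pos x
      exact h1 ▸ (by positivity)
  have h1 : inner ℂ (schrodinger h.potentialPlus u) (u : L2per L) =
      ((-∫ x, W x ∂(haarAddCircle (T := L)) : ℝ) : ℂ) := by
    rw [hAu, hu]
    refine (ContinuousMap.inner_toLp haarAddCircle _ _).trans ?_
    rw [← integral_neg, ← integral_complex_ofReal]
    refine integral_congr_ae (Filter.Eventually.of_forall fun x => ?_)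
    simp [hW, complexify, potMul]
    ring
  rw [h1, Complex.ofReal_re, neg_lt_zero]
  exact integral_pos_of_pos hWpos

/-- `𝓛₊` has exactly one negative eigenvalue, and it is simple. -/
lemma exists_unique_neg_eigenvalue_opPlus (h : IsEvenWave L ω φ) :
    ∃ μ : ℝ, μ < 0 ∧ multiplicity h.opPlus (μ : ℂ) = 1 ∧
      ∀ ν : ℝ, ν < 0 → ν ≠ μ → eigenspace h.opPlus (ν : ℂ) = ⊥ := by
  obtain ⟨a, hq, u, u', hS⟩ := h.exists_sturmData
  obtain ⟨μ, hμ, hne⟩ := h.exists_neg_eigenvalue_opPlus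
  -- Below 0 evaluation at a is injective on eigenfunctions, because they have zero slope there.
  -- This gives simplicity.
  have hzero : ∀ (ν : ℝ) (F : C(AddCircle L, ℂ)), ν < 0 →
      classL2 L F ∈ eigenspace h.opPlus (ν : ℂ) → F (a : AddCircle L) = 0 → classL2 L F = 0 := by
    intro ν F hν hF hFa
    obtain ⟨F', v', w', hFF', hv, hw⟩ := exists_real_solutions h.potentialPlus_coe hF
    obtain rfl := classL2_injective hFF'
    have h1 := hS.periodic_eq_zero rfl hq hν hv (periodic_comp_coe fun x => (F x).re)
      (by simp [hFa])
    have h2 := hS.periodic_eq_zero rfl hq hν hw (periodic_comp_coe fun x => (F x).im)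
      (by simp [hFa])
    rw [eq_smul_of_re_im (G := h.profile) (c := 0) (d := 0) (by simpa using h1)
      (by simpa using h2)]
    exact zero_smul ℂ _
  have hsol : ∀ ν : ℝ, eigenspace h.opPlus (ν : ℂ) ≠ ⊥ → ∃ v v', Function.Periodic v L ∧
      (∃ x, v x ≠ 0) ∧ IsSol (fun x => linePlus ω φ x - ν) v v' := by
    intro ν hν
    obtain ⟨f, hf, hf0⟩ := Submodule.exists_mem_ne_zero_of_ne_bot hν
    obtain ⟨F, v', w', rfl, hv, hw⟩ := exists_real_solutions h.potentialPlus_coe hf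
    by_cases hre : ∃ x : ℝ, (F (x : AddCircle L)).re ≠ 0
    · exact ⟨_, _, periodic_comp_coe fun x => (F x).re, hre, hv⟩
    · refine ⟨_, _, periodic_comp_coe fun x => (F x).im, ?_, hw⟩
      by_contra him
      push Not at hre him
      refine hf0 ?_
      rw [eq_smul_of_re_im (G := h.profile) (c := 0) (d := 0) (by simpa using hre)
        (by simpa using him)]
      exact zero_smul ℂ _
  refine ⟨μ, hμ, ?_, fun ν hν hνμ => ?_⟩
  · obtain ⟨f, hf, hf0⟩ := Submodule.exists_mem_ne_zero_of_ne_bot hne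
    refine multiplicity_eq_one hf0 (le_antisymm (fun g hg => ?_) ?_)
    · obtain ⟨F, -, -, rfl, -, -⟩ := exists_real_solutions h.potentialPlus_coe hf
      obtain ⟨G, -, -, rfl, -, -⟩ := exists_real_solutions h.potentialPlus_coe hg
      have hFa : F (a : AddCircle L) ≠ 0 := fun h0 => hf0 (hzero μ F hμ hf h0)
      have h1 : classL2 L (G - (G (a : AddCircle L) / F (a : AddCircle L)) • F) = 0 := by
        refine hzero μ _ hμ ?_ ?_
        · rw [map_sub, map_smul]
          exact Submodule.sub_mem _ hg (Submodule.smul_mem _ _ hf)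
        · simp [hFa]
      rw [map_sub, map_smul, sub_eq_zero] at h1
      rw [h1]
      exact Submodule.smul_mem _ _ (Submodule.mem_span_singleton_self _)
    · rwa [Submodule.span_singleton_le_iff_mem]
  · by_contra hne'
    obtain ⟨v, v', hp, hv0, hv⟩ := hsol μ hne
    obtain ⟨w, w', hp', hw0, hw⟩ := hsol ν hne'
    exact hνμ (hS.periodic_unique rfl hq hμ hν hv hp hv0 hw hp' hw0).symm

lemma toL2per_profile_ne_zero (h : IsEvenWave L ω φ) : toL2per h.profile ≠ 0 :=
  toL2per_ne_zero (x := ((0 : ℝ) : AddCircle L)) (by rw [h.profile_coe]; exact (h.pos 0).ne')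

lemma toL2per_profileDeriv_ne_zero (h : IsEvenWave L ω φ) : toL2per h.profileDeriv ≠ 0 := by
  obtain ⟨x, hx⟩ := h.exists_deriv_ne_zero
  exact toL2per_ne_zero (x := (x : AddCircle L)) (by rwa [h.profileDeriv_coe])

end IsEvenWave

end PeriodicNLS

end

theorem mainTheorem4 (L ω : ℝ) [Fact (0 < L)] (φ : ℝ → ℝ)
    (h : PeriodicNLS.IsEvenWave L ω φ) :
    -- the operator `𝓛₊`
    (PeriodicNLS.morseIndex h.opPlus = 1 ∧ PeriodicNLS.nullityIndex h.opPlus = 1 ∧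
      PeriodicNLS.eigenspace h.opPlus 0 =
        Submodule.span ℂ {PeriodicNLS.toL2per h.profileDeriv} ∧
      ∃ μ : ℝ, μ < 0 ∧ PeriodicNLS.multiplicity h.opPlus (μ : ℂ) = 1 ∧
        PeriodicNLS.RestIsDiscretePositive h.opPlus {(μ : ℂ), 0}) ∧
    -- the operator `𝓛₋`
    (PeriodicNLS.morseIndex h.opMinus = 0 ∧ PeriodicNLS.nullityIndex h.opMinus = 1 ∧
      PeriodicNLS.eigenspace h.opMinus 0 =
        Submodule.span ℂ {PeriodicNLS.toL2per h.profile} ∧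
      PeriodicNLS.RestIsDiscretePositive h.opMinus {0}) ∧
    -- the Hessian `𝓛 = diag (𝓛₊, 𝓛₋)`
    (PeriodicNLS.morseIndex h.hessian = 1 ∧ PeriodicNLS.nullityIndex h.hessian = 2 ∧
      PeriodicNLS.eigenspace h.hessian 0 =
        Submodule.span ℂ {WithLp.toLp 2 (PeriodicNLS.toL2per h.profileDeriv, 0),
          WithLp.toLp 2 (0, PeriodicNLS.toL2per h.profile)} ∧
      ∃ μ : ℝ, μ < 0 ∧ PeriodicNLS.multiplicity h.hessian (μ : ℂ) = 1 ∧
        PeriodicNLS.RestIsDiscretePositive h.hessian {(μ : ℂ), 0}) := by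
  obtain ⟨μ, hμ, hmul, huniq⟩ := h.exists_unique_neg_eigenvalue_opPlus
  have hPzero := PeriodicNLS.multiplicity_eq_one h.toL2per_profileDeriv_ne_zero
    h.eigenspace_opPlus_zero
  have hMzero := PeriodicNLS.multiplicity_eq_one h.toL2per_profile_ne_zero
    h.eigenspace_opMinus_zero
  have hMneg : ∀ ν : ℝ, ν < 0 → PeriodicNLS.multiplicity h.opMinus (ν : ℂ) = 0 := fun ν hν =>
    PeriodicNLS.multiplicity_eq_zero_iff.2 (h.eigenspace_opMinus_neg hν)
  have hPneg : ∀ ν : ℝ, ν < 0 → ν ≠ μ → PeriodicNLS.multiplicity h.opPlus (ν : ℂ) = 0 :=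
    fun ν hν hne => PeriodicNLS.multiplicity_eq_zero_iff.2 (huniq ν hν hne)
  have hPrest : PeriodicNLS.RestIsDiscretePositive h.opPlus {(μ : ℂ), 0} := by
    refine h.hasCompactResolvent_opPlus.restIsDiscretePositive fun ν hν hνS => ?_
    rw [Set.mem_insert_iff, Set.mem_singleton_iff, not_or, Complex.ofReal_inj,
      Complex.ofReal_eq_zero] at hνS
    exact huniq ν (lt_of_le_of_ne hν hνS.2) hνS.1
  have hMrest : PeriodicNLS.RestIsDiscretePositive h.opMinus {0} := by
    refine h.hasCompactResolvent_opMinus.restIsDiscretePositive fun ν hν hνS => ?_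
    rw [Set.mem_singleton_iff, Complex.ofReal_eq_zero] at hνS
    exact h.eigenspace_opMinus_neg (lt_of_le_of_ne hν hνS)
  have hHmul : ∀ z : ℂ, PeriodicNLS.multiplicity h.hessian z =
      PeriodicNLS.multiplicity h.opPlus z + PeriodicNLS.multiplicity h.opMinus z := fun z =>
    PeriodicNLS.multiplicity_blockDiag
  have hHμ : PeriodicNLS.multiplicity h.hessian (μ : ℂ) = 1 := by
    rw [hHmul, hmul, hMneg μ hμ, add_zero]
  refine ⟨⟨?_, hPzero, h.eigenspace_opPlus_zero, μ, hμ, hmul, hPrest⟩,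
    ⟨PeriodicNLS.morseIndex_eq_zero hMneg, hMzero, h.eigenspace_opMinus_zero, hMrest⟩,
    ⟨?_, ?_, PeriodicNLS.eigenspace_blockDiag_eq_span h.eigenspace_opPlus_zero
      h.eigenspace_opMinus_zero, μ, hμ, hHμ, ?_⟩⟩
  · rw [PeriodicNLS.morseIndex_eq_of_unique hμ hPneg, hmul]
  · rw [PeriodicNLS.morseIndex_eq_of_unique hμ fun ν hν hne => ?_, hHμ]
    rw [hHmul, hPneg ν hν hne, hMneg ν hν, add_zero]
  · rw [PeriodicNLS.nullityIndex, hHmul, hPzero, hMzero]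
    exact one_add_one_eq_two
  -- Both blocks must refer to the same exceptional set, so μ is also excepted for 𝓛₋.
  · refine hPrest.blockDiag (hMrest.mono (by simp)) (fun z => ?_) fun z => ?_
    · have := h.hasCompactResolvent_opPlus.finiteDimensional_eigenspace z
      exact PeriodicNLS.multiplicity_ne_top
    · have := h.hasCompactResolvent_opMinus.finiteDimensional_eigenspace z
      exact PeriodicNLS.multiplicity_ne_top
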